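/- Let $\mathcal G$ be a connected, locally finite metric graph with countable vertex set, without loops or multiple edges, in which every edge $e$ is identified with a real interval of finite length $\ell_e>0$. Equip $\mathcal G$ with Lebesgue measure on its edges and with the geodesic distance (the infimum of the lengths of the paths of finitely many intervals joining two points), and let $\overline{\mathcal G}$ be its metric completion. The boundary $\partial\overline{\mathcal G}$ is the union of the set of vertices with exactly one incident edge and of $\overline{\mathcal G}\setminus\mathcal G$. Suppose that $\overline{\mathcal G}$ is compact, that $\partial\overline{\mathcal G}\neq\emptyset$, and that $\overline{\mathcal G}$ is weakly connected: for all distinct $x,y\in\overline{\mathcal G}$ there are a finite set $W\subset\mathcal G$ and disjoint open sets $A\ni x$, $B\ni y$ with $\overline{\mathcal G}\setminus W=A\cup B$. Let $q:\mathcal G\to\mathbb R$ be nonnegative and locally integrable (that is, integrable on each closed edge), and suppose there is a weight $\omega$, assigning to each edge $e$ a number $\omega(e)>0$, such that $$\sum_e\omega(e)<\infty\qquad\text{and}\qquad \int_{\mathcal G}(\omega^{-1}q)^2\,\omega=\sum_e\int_e\bigl(\omega(e)^{-1}q(x)\bigr)^2\omega(e)\,dx<\infty .$$ A function $u:\mathcal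 G\to\mathbb R$ is called $q$-harmonic if on each closed edge $u$ is differentiable (one-sidedly at the ends), $u'$ is absolutely continuous and $u''=qu$ almost everywhere; $u$ is continuous at each vertex of degree at least $2$; and at each such vertex the derivatives of $u$ along the incident edges, taken in the directions pointing away from the vertex, add up to $0$. Then every continuous function $U:\partial\overline{\mathcal G}\to\mathbb R$ has a unique extension to a continuous function $u:\overline{\mathcal G}\to\mathbb R$ that is $q$-harmonic on $\mathcal G$. -/

import Mathlib

open Set MeasureTheory

/-- A locally finite metric graph with vertex set `V`: a simple graph (no loops, no multiple edges)
in which every vertex has finitely many neighbours, and a positive finite length for each edge. -/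
structure MetricGraph (V : Type*) where
  graph : SimpleGraph V
  locallyFinite : graph.LocallyFinite
  length : graph.edgeSet → ℝ
  length_pos : ∀ e, 0 < length e

namespace MetricGraph

variable {V : Type*} (G : MetricGraph V)

instance instLocallyFinite : G.graph.LocallyFinite := G.locallyFinite

/-- The length of the (unoriented) edge underlying an oriented edge `d`. -/
def dartLength (d : G.graph.Dart) : ℝ := G.length ⟨d.edge, d.edge_mem⟩

theorem dartLength_symm (d : G.graph.Dart) : G.dartLength d.symm = G.dartLength d := by
  unfold dartLength
  congr 2
  exact d.edge_symm

theorem dartLength_pos (d : G.graph.Dart) : 0 < G.dartLength d := G.length_pos _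

/-- The disjoint union of the vertices and of one interval `[0, ℓ]` for each oriented edge,
before gluing. -/
inductive PrePoint : Type _
  | vertex (v : V) : PrePoint
  | onDart (d : G.graph.Dart) (t : Icc (0 : ℝ) (G.dartLength d)) : PrePoint

/-- The gluing: the coordinate `0` on an oriented edge is its initial vertex, and the two
orientations of an edge give the same interval, with coordinates related by `t ↦ ℓ - t`. -/
inductive Glue : G.PrePoint → G.PrePoint → Prop
  | start (d : G.graph.Dart) :
      Glue (.onDart d ⟨0, left_mem_Icc.2 (G.dartLength_pos d).le⟩) (.vertex d.fst)
  | flip (d : G.graph.Dart) (t : Icc (0 : ℝ) (G.dartLength d))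
      (t' : Icc (0 : ℝ) (G.dartLength d.symm)) (h : (t' : ℝ) = G.dartLength d - t) :
      Glue (.onDart d t) (.onDart d.symm t')

/-- The points of the metric graph: vertices and edge points, glued together. -/
def Point : Type _ := Quot G.Glue

/-- A vertex, as a point of the metric graph. -/
def vertexPoint (v : V) : G.Point := Quot.mk _ (.vertex v)

/-- The point with coordinate `t ∈ [0, ℓ]` on the oriented edge `d`
(real numbers outside `[0, ℓ]` are sent to the nearest endpoint). -/
noncomputable def dartPoint (d : G.graph.Dart) (t : ℝ) : G.Point :=
  Quot.mk _ (.onDart d (projIcc 0 (G.dartLength d) (G.dartLength_pos d).le t))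

/-- `G.HasPath x y L`: there is a path from `x` to `y` of total length `L` that consists of
finitely many intervals, each one contained in an edge. -/
inductive HasPath (x : G.Point) : G.Point → ℝ → Prop
  | refl : HasPath x x 0
  | step {L : ℝ} (d : G.graph.Dart) (s t : ℝ)
      (hs : s ∈ Icc 0 (G.dartLength d)) (ht : t ∈ Icc 0 (G.dartLength d))
      (h : HasPath x (G.dartPoint d s) L) :
      HasPath x (G.dartPoint d t) (L + |t - s|)

variable {G}

theorem HasPath.nonneg {x y : G.Point} {L : ℝ} (h : G.HasPath x y L) : 0 ≤ L := by
  induction h with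
  | refl => exact le_rfl
  | step d s t hs ht h ih => positivity

theorem HasPath.trans {x y z : G.Point} {L M : ℝ} (h : G.HasPath x y L) (h' : G.HasPath y z M) :
    G.HasPath x z (L + M) := by
  induction h' with
  | refl => simpa using h
  | step d s t hs ht _ ih =>
    rw [← add_assoc]
    exact .step d s t hs ht ih

theorem HasPath.symm {x y : G.Point} {L : ℝ} (h : G.HasPath x y L) : G.HasPath y x L := by
  induction h with
  | refl => exact .refl
  | step d s t hs ht _ ih =>
    have h1 := HasPath.step d t s ht hs (HasPath.refl (x := G.dartPoint d t))
    have h2 := h1.trans ih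
    rwa [zero_add, abs_sub_comm, add_comm] at h2

variable (G)

/-- The geodesic distance: the infimum of the lengths of the paths that join two points. It is
finite if the graph is connected. (By local finiteness distinct points have positive distance, so
this is a genuine metric on a connected graph.) -/
noncomputable instance instPseudoEMetricSpace : PseudoEMetricSpace G.Point where
  edist x y := ⨅ (L : ℝ) (_ : G.HasPath x y L), ENNReal.ofReal L
  edist_self x := le_antisymm ((iInf₂_le 0 .refl).trans (by simp)) zero_le
  edist_comm x y := by
    have key : ∀ x y : G.Point, (⨅ (L : ℝ) (_ : G.HasPath x y L), ENNReal.ofReal L) ≤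
        ⨅ (L : ℝ) (_ : G.HasPath y x L), ENNReal.ofReal L :=
      fun x y => le_iInf₂ fun L h => iInf₂_le L h.symm
    exact le_antisymm (key x y) (key y x)
  edist_triangle x y z := by
    simp only [ENNReal.iInf_add, ENNReal.add_iInf]
    refine le_iInf fun M => le_iInf fun h' => le_iInf fun L => le_iInf fun h => ?_
    rw [← ENNReal.ofReal_add h.nonneg h'.nonneg]
    exact iInf₂_le (L + M) (h.trans h')

/-- The metric completion `Ḡ` of the metric graph. -/
abbrev Completion : Type _ := UniformSpace.Completion G.Point

/-- The copy of the metric graph inside its completion. -/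
def inCompletion : Set G.Completion := range ((↑) : G.Point → G.Completion)

/-- The boundary `∂Ḡ`: the vertices with exactly one incident edge, together with the points of
the completion that are not in the graph. -/
def boundary : Set G.Completion :=
  {x | ∃ v, G.graph.degree v = 1 ∧ x = (G.vertexPoint v : G.Completion)} ∪ G.inCompletionᶜ

/-- `Ḡ` is weakly connected: any two distinct points of `Ḡ` are separated by the removal of a
finite set of points of the graph. -/
def WeaklyConnected : Prop :=
  ∀ x y : G.Completion, x ≠ y → ∃ W : Set G.Completion, W.Finite ∧ W ⊆ G.inCompletion ∧
    ∃ A B : Set G.Completion, IsOpen A ∧ IsOpen B ∧ Disjoint A B ∧ Wᶜ = A ∪ B ∧ x ∈ A ∧ y ∈ B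

/-- The expression of a function on the metric graph in the coordinate `t ∈ [0, ℓ]` of the
oriented edge `d`. -/
noncomputable def onDart (f : G.Point → ℝ) (d : G.graph.Dart) (t : ℝ) : ℝ := f (G.dartPoint d t)

/-- The derivative along the oriented edge `d`, one-sided at the two ends of the edge. -/
noncomputable def derivOnDart (f : G.Point → ℝ) (d : G.graph.Dart) (t : ℝ) : ℝ :=
  derivWithin (G.onDart f d) (Icc 0 (G.dartLength d)) t

theorem exists_dart (e : G.graph.edgeSet) : ∃ d : G.graph.Dart, d.edge = e := by
  obtain ⟨e, he⟩ := e
  induction e using Sym2.ind with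
  | _ v w => exact ⟨⟨(v, w), he⟩, rfl⟩

/-- A choice of orientation of an edge. -/
noncomputable def orient (e : G.graph.edgeSet) : G.graph.Dart := (G.exists_dart e).choose

/-- The integral over an edge, for Lebesgue measure on the edge, of a nonnegative function. (It does
not depend on the orientation that is used to compute it.) -/
noncomputable def edgeIntegral (f : G.Point → ENNReal) (e : G.graph.edgeSet) : ENNReal :=
  ∫⁻ t in Icc 0 (G.length e), f (G.dartPoint (G.orient e) t)

/-- Local integrability on the metric graph. As the graph is locally finite, and as the endpoints
of its edges belong to it, this is integrability on each closed edge. -/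
def LocallyIntegrable (q : G.Point → ℝ) : Prop :=
  ∀ d : G.graph.Dart, IntegrableOn (G.onDart q d) (Icc 0 (G.dartLength d))

/-- `u` is `q`-harmonic: on each closed edge `u` is differentiable, `u'` is absolutely continuous,
and `u'' = q u` almost everywhere; and at each vertex of degree at least two the derivatives along
the incident edges, in the directions pointing away from the vertex, add up to zero. (The
limits at a vertex of `u` along the incident edges agree, since all of them are the value of `u`.) -/
structure IsHarmonic (q u : G.Point → ℝ) : Prop where
  differentiableOn : ∀ d, DifferentiableOn ℝ (G.onDart u d) (Icc 0 (G.dartLength d))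
  absolutelyContinuous : ∀ d, AbsolutelyContinuousOnInterval (G.derivOnDart u d) 0 (G.dartLength d)
  equation : ∀ d, ∀ᵐ t : ℝ, t ∈ Ioo 0 (G.dartLength d) →
    HasDerivAt (G.derivOnDart u d) (G.onDart q d t * G.onDart u d t) t
  junction : ∀ v, 2 ≤ G.graph.degree v →
    ∑ w : G.graph.neighborSet v, G.derivOnDart u (G.graph.dartOfNeighborSet v w) 0 = 0

end MetricGraph

/-!
The problem is reduced to a discrete one. On an edge the initial value problem `y'' = q y`, `y 0 = 0`,
`y' 0 = 1` has a positive convex solution (`exists_isSchrodingerSolution`), so that vertex values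
`F : V → ℝ` can be interpolated along the edges by solutions of `u'' = q u` (`EdgeProfile.interp`).
The interpolation is `q`-harmonic if `F` solves a Schrödinger equation on the underlying graph, with
conductances `c = 1 / y ℓ` and a nonnegative potential `m` (`exists_edgeProfile`). The conductances do
not depend on the orientation, since the Wronskian is constant. The weight `ω` serves to show that `q`
is integrable over the whole graph (`summable_potentialIntegral`); hence `∑ m < ∞`, and the
interpolation is almost linear on all but finitely many edges.

For boundary values that come from a continuous function `Φ` on the completion that is constant on all
but finitely many edges, the discrete equation is solved by orthogonal projection in the energy space
(`exists_discrete_solution`). Along a simple path, the Cauchy–Schwarz inequality bounds the oscillation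
of a function by its energy; and compactness bounds the distances between vertices, since the linear
interpolation of the distance from a fixed vertex is uniformly continuous
(`exists_walkLength_le`). So convergence in energy is uniform convergence, and the solution is `Φ` minus
a uniform limit of finitely supported functions, which gives its continuity and its boundary values
(`exists_solution_of_eventuallyFlat`).

The square of a `q`-harmonic function is convex on the edges and satisfies the Kirchhoff condition,
whence the maximum principle `IsHarmonic.abs_le_of_boundary`, and with it uniqueness. Weak
connectedness says that the functions `Φ` above separate the boundary points
(`exists_eventuallyFlat_ne`), so their restrictions are dense by the Stone–Weierstrass theorem; by the
maximum principle, the solutions for approximating boundary values converge uniformly, and the discrete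
equation passes to the limit (`exists_harmonic_extension`).
-/

/-! ### Absolutely continuous functions and solutions of `y'' = q y` on an interval -/

open Filter Topology in
theorem AbsolutelyContinuousOnInterval.congr_eqOn {f g : ℝ → ℝ} {a b : ℝ}
    (hf : AbsolutelyContinuousOnInterval f a b) (h : EqOn f g (uIcc a b)) :
    AbsolutelyContinuousOnInterval g a b := by
  refine Tendsto.congr' ?_ hf
  filter_upwards [mem_inf_of_right (mem_principal_self _)] with E hE
  refine Finset.sum_congr rfl fun i hi => ?_
  rw [h (hE.1 i hi).1, h (hE.1 i hi).2]

theorem AbsolutelyContinuousOnInterval.monotoneOn_of_ae_deriv_nonneg {f : ℝ → ℝ} {a b : ℝ}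
    (hab : a ≤ b) (hf : AbsolutelyContinuousOnInterval f a b)
    (h : ∀ᵐ t : ℝ, t ∈ Ioo a b → 0 ≤ deriv f t) : MonotoneOn f (Icc a b) := by
  intro s hs t ht hst
  have h1 : AbsolutelyContinuousOnInterval f s t := hf.mono (by
    rw [uIcc_of_le hst, uIcc_of_le hab]; exact Icc_subset_Icc hs.1 ht.2)
  rw [← sub_nonneg, ← h1.integral_deriv_eq_sub]
  refine intervalIntegral.integral_nonneg_of_ae_restrict hst ?_
  rw [Filter.EventuallyLE, ← restrict_Ioo_eq_restrict_Icc, ae_restrict_iff' measurableSet_Ioo]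
  filter_upwards [h] with x hx hx'
  exact hx ⟨hs.1.trans_lt hx'.1, hx'.2.trans_le ht.2⟩

/-- `y` solves `y'' = q y` on `[0, ℓ]` in the sense of Carathéodory, and `z` is its derivative. -/
structure IsSchrodingerSolution (q : ℝ → ℝ) (ℓ : ℝ) (y z : ℝ → ℝ) : Prop where
  hasDerivWithinAt : ∀ t ∈ Icc 0 ℓ, HasDerivWithinAt y (z t) (Icc 0 ℓ) t
  absolutelyContinuous : AbsolutelyContinuousOnInterval z 0 ℓ
  equation : ∀ᵐ t : ℝ, t ∈ Ioo 0 ℓ → HasDerivAt z (q t * y t) t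

namespace IsSchrodingerSolution

variable {q : ℝ → ℝ} {ℓ : ℝ} {y z y' z' : ℝ → ℝ}

theorem linearCombination (h : IsSchrodingerSolution q ℓ y z) (h' : IsSchrodingerSolution q ℓ y' z')
    (a b : ℝ) :
    IsSchrodingerSolution q ℓ (fun t => a * y t + b * y' t) (fun t => a * z t + b * z' t) where
  hasDerivWithinAt t ht := ((h.hasDerivWithinAt t ht).const_mul a).add
    ((h'.hasDerivWithinAt t ht).const_mul b)
  absolutelyContinuous := (h.absolutelyContinuous.const_mul a).add
    (h'.absolutelyContinuous.const_mul b)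
  equation := by
    filter_upwards [h.equation, h'.equation] with t ht ht' hI
    convert! ((ht hI).const_mul a).add ((ht' hI).const_mul b) using 1
    ring

theorem continuousOn (h : IsSchrodingerSolution q ℓ y z) : ContinuousOn y (Icc 0 ℓ) :=
  fun t ht => (h.hasDerivWithinAt t ht).continuousWithinAt

theorem continuousOn_deriv (h : IsSchrodingerSolution q ℓ y z) (hℓ : 0 < ℓ) :
    ContinuousOn z (Icc 0 ℓ) := by
  simpa [uIcc_of_le hℓ.le] using h.absolutelyContinuous.continuousOn

theorem hasDerivAt (h : IsSchrodingerSolution q ℓ y z) {t : ℝ} (ht : t ∈ Ioo 0 ℓ) :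
    HasDerivAt y (z t) t :=
  (h.hasDerivWithinAt t (Ioo_subset_Icc_self ht)).hasDerivAt (Icc_mem_nhds ht.1 ht.2)

theorem exists_lipschitz (h : IsSchrodingerSolution q ℓ y z) (hℓ : 0 < ℓ) :
    ∃ K : NNReal, LipschitzOnWith K y (Icc 0 ℓ) := by
  obtain ⟨C, hC⟩ := isCompact_Icc.exists_bound_of_continuousOn (h.continuousOn_deriv hℓ)
  refine ⟨C.toNNReal, (convex_Icc 0 ℓ).lipschitzOnWith_of_nnnorm_hasDerivWithin_le
    h.hasDerivWithinAt fun t ht => ?_⟩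
  rw [← NNReal.coe_le_coe, coe_nnnorm]
  exact (hC t ht).trans (Real.le_coe_toNNReal C)

theorem absolutelyContinuous_self (h : IsSchrodingerSolution q ℓ y z) (hℓ : 0 < ℓ) :
    AbsolutelyContinuousOnInterval y 0 ℓ := by
  obtain ⟨K, hK⟩ := h.exists_lipschitz hℓ
  rw [← uIcc_of_le hℓ.le] at hK
  exact hK.absolutelyContinuousOnInterval

theorem intervalIntegrable (h : IsSchrodingerSolution q ℓ y z) (hℓ : 0 < ℓ) :
    IntervalIntegrable (fun t => q t * y t) volume 0 ℓ := by
  refine h.absolutelyContinuous.intervalIntegrable_deriv.congr_ae ?_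
  rw [uIoc_of_le hℓ.le, ← restrict_Ioo_eq_restrict_Ioc, Filter.EventuallyEq,
    ae_restrict_iff' measurableSet_Ioo]
  filter_upwards [h.equation] with t ht hI using (ht hI).deriv

theorem integral_eq_sub (h : IsSchrodingerSolution q ℓ y z) (hℓ : 0 < ℓ) {s t : ℝ}
    (hs : 0 ≤ s) (hst : s ≤ t) (ht : t ≤ ℓ) : ∫ r in s..t, q r * y r = z t - z s := by
  have h1 : AbsolutelyContinuousOnInterval z s t := h.absolutelyContinuous.mono (by
    rw [uIcc_of_le hst, uIcc_of_le hℓ.le]; exact Icc_subset_Icc hs ht)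
  rw [← h1.integral_deriv_eq_sub]
  rw [intervalIntegral.integral_of_le hst, intervalIntegral.integral_of_le hst,
    integral_Ioc_eq_integral_Ioo, integral_Ioc_eq_integral_Ioo]
  refine setIntegral_congr_ae measurableSet_Ioo ?_
  filter_upwards [h.equation] with r hr hI
  exact (hr ⟨hs.trans_lt hI.1, hI.2.trans_le ht⟩).deriv.symm

/-- The reflection `t ↦ ℓ - t` of the interval carries solutions to solutions. -/
theorem reflect (h : IsSchrodingerSolution q ℓ y z) (hℓ : 0 < ℓ) :
    IsSchrodingerSolution (fun t => q (ℓ - t)) ℓ (fun t => y (ℓ - t)) (fun t => -z (ℓ - t)) where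
  hasDerivWithinAt t ht := by
    have h1 := h.hasDerivWithinAt (ℓ - t) ⟨by linarith [ht.2], by linarith [ht.1]⟩
    have h2 : HasDerivWithinAt (fun t => ℓ - t) (-1) (Icc 0 ℓ) t :=
      ((hasDerivAt_id t).const_sub ℓ).hasDerivWithinAt
    have h3 := HasDerivWithinAt.scomp t h1 h2 (fun s hs => ⟨by linarith [hs.2], by linarith [hs.1]⟩)
    convert! h3 using 1
    simp
  absolutelyContinuous := by
    have h1 : IntervalIntegrable (fun t => q (ℓ - t) * y (ℓ - t)) volume 0 ℓ := by
      have := (h.intervalIntegrable hℓ).comp_sub_left ℓ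
      simpa using this.symm
    have h2 := h1.absolutelyContinuousOnInterval_intervalIntegral (c := 0) (by simp)
    have h3 : AbsolutelyContinuousOnInterval (fun _ : ℝ => -z ℓ) 0 ℓ :=
      ((LipschitzWith.const (-z ℓ)).lipschitzOnWith (K := 0)).absolutelyContinuousOnInterval
    refine (h3.add h2).congr_eqOn fun t ht => ?_
    rw [uIcc_of_le hℓ.le] at ht
    have h4 := intervalIntegral.integral_comp_sub_left (fun r => q r * y r) ℓ (a := 0) (b := t)
    have h5 := h.integral_eq_sub hℓ (s := ℓ - t) (t := ℓ) (by linarith [ht.2]) (by linarith [ht.1])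
      le_rfl
    simp only [Pi.add_apply]
    rw [h4, sub_zero, h5]; ring
  equation := by
    have h1 : Measure.QuasiMeasurePreserving (fun t : ℝ => ℓ - t) volume volume :=
      (volume.measurePreserving_sub_left ℓ).quasiMeasurePreserving
    filter_upwards [h1.ae h.equation] with t ht hI
    have h2 := ht ⟨by linarith [hI.2], by linarith [hI.1]⟩
    convert! (h2.scomp t ((hasDerivAt_id t).const_sub ℓ)).neg using 1
    simp

theorem congr_potential {q' : ℝ → ℝ} (h : IsSchrodingerSolution q ℓ y z)
    (hq : EqOn q q' (Icc 0 ℓ)) : IsSchrodingerSolution q' ℓ y z where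
  hasDerivWithinAt := h.hasDerivWithinAt
  absolutelyContinuous := h.absolutelyContinuous
  equation := by
    filter_upwards [h.equation] with t ht hI
    rw [← hq (Ioo_subset_Icc_self hI)]; exact ht hI

theorem congr_solution (h : IsSchrodingerSolution q ℓ y z) (hy : EqOn y' y (Icc 0 ℓ)) :
    IsSchrodingerSolution q ℓ y' z where
  hasDerivWithinAt t ht := (h.hasDerivWithinAt t ht).congr hy (hy ht)
  absolutelyContinuous := h.absolutelyContinuous
  equation := by
    filter_upwards [h.equation] with t ht hI
    rw [hy (Ioo_subset_Icc_self hI)]; exact ht hI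

/-- The Wronskian of two solutions is constant. -/
theorem wronskian (h : IsSchrodingerSolution q ℓ y z) (h' : IsSchrodingerSolution q ℓ y' z')
    (hℓ : 0 < ℓ) : y 0 * z' 0 - y' 0 * z 0 = y ℓ * z' ℓ - y' ℓ * z ℓ := by
  have hW : AbsolutelyContinuousOnInterval (y * z' - y' * z) 0 ℓ :=
    ((h.absolutelyContinuous_self hℓ).mul h'.absolutelyContinuous).sub
      ((h'.absolutelyContinuous_self hℓ).mul h.absolutelyContinuous)
  have hd : ∀ᵐ t : ℝ, t ∈ Ioo 0 ℓ → deriv (y * z' - y' * z) t = 0 := by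
    filter_upwards [h.equation, h'.equation] with t ht ht' hI
    rw [(((h.hasDerivAt hI).mul (ht' hI)).sub ((h'.hasDerivAt hI).mul (ht hI))).deriv]
    ring
  have h1 := hW.integral_deriv_eq_sub
  rw [intervalIntegral.integral_of_le hℓ.le, integral_Ioc_eq_integral_Ioo,
    setIntegral_congr_ae measurableSet_Ioo (g := fun _ => 0) hd] at h1
  simp at h1
  linarith

/-- If `q ≥ 0`, then the derivative `2 y y'` of the square of a solution is nondecreasing, whatever
the sign of the solution. -/
theorem monotoneOn_mul (h : IsSchrodingerSolution q ℓ y z) (hℓ : 0 < ℓ)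
    (hq : ∀ t ∈ Icc 0 ℓ, 0 ≤ q t) : MonotoneOn (fun t => y t * z t) (Icc 0 ℓ) := by
  refine AbsolutelyContinuousOnInterval.monotoneOn_of_ae_deriv_nonneg hℓ.le
    ((h.absolutelyContinuous_self hℓ).mul h.absolutelyContinuous) ?_
  filter_upwards [h.equation] with t ht hI
  rw [((h.hasDerivAt hI).fun_mul (ht hI)).deriv]
  nlinarith [mul_self_nonneg (z t), mul_nonneg (hq t (Ioo_subset_Icc_self hI))
    (mul_self_nonneg (y t))]

theorem monotoneOn_deriv (h : IsSchrodingerSolution q ℓ y z) (hℓ : 0 < ℓ)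
    (hq : ∀ t ∈ Icc 0 ℓ, 0 ≤ q t) (hy : ∀ t ∈ Icc 0 ℓ, 0 ≤ y t) : MonotoneOn z (Icc 0 ℓ) := by
  refine AbsolutelyContinuousOnInterval.monotoneOn_of_ae_deriv_nonneg hℓ.le
    h.absolutelyContinuous ?_
  filter_upwards [h.equation] with t ht hI
  rw [(ht hI).deriv]
  exact mul_nonneg (hq t (Ioo_subset_Icc_self hI)) (hy t (Ioo_subset_Icc_self hI))

end IsSchrodingerSolution

theorem convexOn_of_hasDerivWithinAt_monotoneOn {ℓ : ℝ} {y z : ℝ → ℝ}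
    (h : ∀ t ∈ Icc 0 ℓ, HasDerivWithinAt y (z t) (Icc 0 ℓ) t) (hz : MonotoneOn z (Icc 0 ℓ)) :
    ConvexOn ℝ (Icc 0 ℓ) y := by
  have h' : ∀ t ∈ Ioo 0 ℓ, HasDerivAt y (z t) t := fun t ht =>
    (h t (Ioo_subset_Icc_self ht)).hasDerivAt (Icc_mem_nhds ht.1 ht.2)
  refine MonotoneOn.convexOn_of_deriv (convex_Icc 0 ℓ)
    (fun t ht => (h t ht).continuousWithinAt) ?_ ?_
  · rw [interior_Icc]
    exact fun t ht => (h' t ht).differentiableAt.differentiableWithinAt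
  · rw [interior_Icc]
    intro s hs t ht hst
    rw [(h' s hs).deriv, (h' t ht).deriv]
    exact hz (Ioo_subset_Icc_self hs) (Ioo_subset_Icc_self ht) hst

/-! ### The initial value problem -/

/-- A Volterra integral equation of the second kind with an integrable weight. In the norm weighted
by `exp (-L t)` the integral operator has the kernel `(t - s)⁺ exp (-L (t - s)) ≤ 1 / L`, so that it
is a contraction for large `L`. -/
theorem exists_volterra_solution {Q : ℝ → ℝ} (hQ : Integrable Q) (hQ0 : ∀ s, 0 ≤ Q s) :
    ∃ y : ℝ → ℝ, Continuous y ∧ (∀ t, 0 ≤ y t) ∧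
      ∀ t, y t = max t 0 + ∫ s, max (t - s) 0 * (Q s * y s) := by
  -- `L` is so large that the integral operator has norm at most `1 / 2`
  obtain ⟨L, hL0, hL⟩ : ∃ L : ℝ, 0 < L ∧ 1 / L * ∫ s, Q s ≤ 1 / 2 := by
    have hI : 0 ≤ ∫ s, Q s := integral_nonneg hQ0
    refine ⟨2 * (∫ s, Q s) + 1, by positivity, ?_⟩
    rw [one_div_mul_eq_div, div_le_div_iff₀ (by positivity) two_pos]; linarith
  set k : ℝ → ℝ := fun r => max r 0 * Real.exp (-(L * r)) with hk
  have k_cont : Continuous k := by fun_prop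
  have k_nonneg : ∀ r, 0 ≤ k r := fun r => by positivity
  have k_le : ∀ r, k r ≤ 1 / L := by
    intro r
    rcases le_total r 0 with hr | hr
    · rw [hk]; simp only [max_eq_right hr, zero_mul]; positivity
    · rw [hk]; simp only [max_eq_left hr]
      rw [Real.exp_neg, ← div_eq_mul_inv, div_le_div_iff₀ (Real.exp_pos _) hL0]
      linarith [Real.add_one_le_exp (L * r)]
  have k_int : ∀ (w : BoundedContinuousFunction ℝ ℝ) t,
      Integrable fun s => k (t - s) * (Q s * w s) := by
    intro w t
    refine (hQ.mul_bdd (c := ‖w‖) w.continuous.aestronglyMeasurable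
      (ae_of_all _ w.norm_coe_le_norm)).bdd_mul (c := 1 / L)
      (k_cont.comp (continuous_const.sub continuous_id)).aestronglyMeasurable (ae_of_all _ ?_)
    intro s
    rw [Real.norm_of_nonneg (k_nonneg _)]; exact k_le _
  have k_bound : ∀ (w : BoundedContinuousFunction ℝ ℝ) t s,
      ‖k (t - s) * (Q s * w s)‖ ≤ 1 / L * (Q s * ‖w‖) := by
    intro w t s
    rw [norm_mul (k (t - s)) (Q s * w s), norm_mul (Q s), Real.norm_of_nonneg (k_nonneg _), Real.norm_of_nonneg (hQ0 _)]
    exact mul_le_mul (k_le _) (mul_le_mul_of_nonneg_left (w.norm_coe_le_norm s) (hQ0 s))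
      (mul_nonneg (hQ0 s) (norm_nonneg _)) (by positivity)
  have T_cont : ∀ w : BoundedContinuousFunction ℝ ℝ,
      Continuous fun t => k t + ∫ s, k (t - s) * (Q s * w s) := by
    intro w
    refine k_cont.add (continuous_of_dominated (bound := fun s => 1 / L * (Q s * ‖w‖))
      (fun t => (k_int w t).aestronglyMeasurable) ?_ ((hQ.mul_const _).const_mul _) ?_)
    · exact fun t => ae_of_all _ (k_bound w t)
    · refine ae_of_all _ fun s => ?_
      exact (k_cont.comp (continuous_id.sub continuous_const)).mul continuous_const
  have T_bound : ∀ (w : BoundedContinuousFunction ℝ ℝ) t,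
      ‖∫ s, k (t - s) * (Q s * w s)‖ ≤ 1 / 2 * ‖w‖ := by
    intro w t
    calc ‖∫ s, k (t - s) * (Q s * w s)‖ ≤ ∫ s, 1 / L * (Q s * ‖w‖) := by
          refine norm_integral_le_of_norm_le ((hQ.mul_const _).const_mul _) (ae_of_all _
            (k_bound w t))
      _ = (1 / L * ∫ s, Q s) * ‖w‖ := by
          rw [integral_const_mul, integral_mul_const]; ring
      _ ≤ 1 / 2 * ‖w‖ := by gcongr
  let T : BoundedContinuousFunction ℝ ℝ → BoundedContinuousFunction ℝ ℝ := fun w =>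
    BoundedContinuousFunction.ofNormedAddCommGroup
      (fun t => k t + ∫ s, k (t - s) * (Q s * w s)) (T_cont w) (1 / L + 1 / 2 * ‖w‖) fun t =>
        (norm_add_le _ _).trans (add_le_add
          (by rw [Real.norm_of_nonneg (k_nonneg _)]; exact k_le t) (T_bound w t))
  have T_apply : ∀ w t, T w t = k t + ∫ s, k (t - s) * (Q s * w s) := fun w t => rfl
  have hT : ContractingWith (1 / 2) T := by
    refine ⟨by rw [← NNReal.coe_lt_coe]; norm_num, LipschitzWith.of_dist_le_mul fun w w' => ?_⟩
    rw [BoundedContinuousFunction.dist_le (by positivity)]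
    intro t
    rw [T_apply, T_apply, dist_eq_norm, add_sub_add_left_eq_sub,
      ← integral_sub (k_int w t) (k_int w' t)]
    have := T_bound (w - w') t
    rw [dist_eq_norm]
    convert! this using 4 with s
    simp; ring
  set w := ContractingWith.fixedPoint T hT with hw
  have hw_eq : ∀ t, w t = k t + ∫ s, k (t - s) * (Q s * w s) := by
    intro t
    rw [← T_apply, hT.fixedPoint_isFixedPt.eq]
  -- the iteration that starts from zero stays nonnegative
  have hw_nonneg : ∀ t, 0 ≤ w t := by
    intro t
    have h1 : ∀ t, Filter.Tendsto (fun n => (T^[n] 0) t) Filter.atTop (nhds (w t)) := fun t =>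
      ((BoundedContinuousFunction.lipschitz_eval_const t).continuous.tendsto w).comp
        (hT.tendsto_iterate_fixedPoint (0 : BoundedContinuousFunction ℝ ℝ))
    refine ge_of_tendsto' (h1 t) fun n => ?_
    induction n generalizing t with
    | zero => simp
    | succ n ih =>
      rw [Function.iterate_succ_apply', T_apply]
      refine add_nonneg (k_nonneg _) (integral_nonneg fun s => ?_)
      exact mul_nonneg (k_nonneg _) (mul_nonneg (hQ0 s) (ih s))
  refine ⟨fun t => Real.exp (L * t) * w t, by fun_prop,
    fun t => mul_nonneg (Real.exp_pos _).le (hw_nonneg t), fun t => ?_⟩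
  simp only
  rw [hw_eq t, mul_add, ← integral_const_mul]
  congr 1
  · rw [hk]; simp only
    rw [mul_left_comm, ← Real.exp_add]; simp
  · refine integral_congr_ae (ae_of_all _ fun s => ?_)
    simp only [hk]
    have : Real.exp (L * t) * Real.exp (-(L * (t - s))) = Real.exp (L * s) := by
      rw [← Real.exp_add]; ring_nf
    linear_combination (max (t - s) 0 * (Q s * w s)) * this

/-- Differentiation under the integral sign; the vanishing on `(-∞, 0)` makes the integrand
integrable. -/
theorem hasDerivAt_integral_posPart_mul {f : ℝ → ℝ} (hf : Integrable f)
    (hf0 : ∀ s < 0, f s = 0) (t : ℝ) :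
    HasDerivAt (fun t => ∫ s, max (t - s) 0 * f s) (∫ s in Iio t, f s) t := by
  have hlip : ∀ s x x' : ℝ, |max (x - s) 0 - max (x' - s) 0| ≤ |x - x'| := fun s x x' => by
    simpa using abs_max_sub_max_le_abs (x - s) (x' - s) 0
  have hint : ∀ x, AEStronglyMeasurable (fun s => max (x - s) 0 * f s) := fun x =>
    (by fun_prop : Continuous fun s : ℝ => max (x - s) 0).aestronglyMeasurable.mul
      hf.aestronglyMeasurable
  have hmain := hasDerivAt_integral_of_dominated_loc_of_lip (μ := volume) (𝕜 := ℝ)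
    (F := fun x s => max (x - s) 0 * f s) (F' := (Iio t).indicator f) (x₀ := t) (s := univ)
    (bound := fun s => ‖f s‖) Filter.univ_mem (Filter.Eventually.of_forall hint) ?_
    (hf.aestronglyMeasurable.indicator measurableSet_Iio) ?_ hf.norm ?_
  · rw [← integral_indicator measurableSet_Iio]; exact hmain.2
  · refine (hf.norm.const_mul |t|).mono' (hint t) (ae_of_all _ fun s => ?_)
    rcases lt_or_ge s 0 with hs | hs
    · simp [hf0 s hs]
    · rw [norm_mul]
      gcongr
      rw [Real.norm_of_nonneg (le_max_right _ _)]
      exact max_le ((by linarith : t - s ≤ t).trans (le_abs_self t)) (abs_nonneg t)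
  · refine ae_of_all _ fun s => LipschitzOnWith.of_dist_le_mul fun x _ x' _ => ?_
    rw [Real.dist_eq, ← sub_mul, abs_mul, mul_comm, Real.dist_eq]
    simp only [Real.norm_eq_abs, Real.coe_nnabs, abs_abs]
    exact mul_le_mul_of_nonneg_left (hlip s x x') (abs_nonneg _)
  · filter_upwards [compl_mem_ae_iff.2 (measure_singleton t)] with s hs
    rcases lt_or_gt_of_ne (hs : s ≠ t) with h | h
    · rw [indicator_of_mem (show s ∈ Iio t from h)]
      have h1 := (((hasDerivAt_id t).sub_const s).mul_const (f s))
      rw [one_mul] at h1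
      refine h1.congr_of_eventuallyEq ?_
      filter_upwards [lt_mem_nhds h] with x hx
      rw [max_eq_left (by linarith)]; rfl
    · rw [indicator_of_notMem (show s ∉ Iio t from not_lt.2 h.le)]
      refine (hasDerivAt_const t (0 : ℝ)).congr_of_eventuallyEq ?_
      filter_upwards [gt_mem_nhds h] with x hx
      rw [max_eq_right (by linarith), zero_mul]

/-- The initial value problem `y'' = q y`, `y 0 = 0`, `y' 0 = 1` has a nonnegative solution if `q`
is nonnegative and integrable. -/
theorem exists_isSchrodingerSolution {q : ℝ → ℝ} {ℓ : ℝ} (hℓ : 0 < ℓ)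
    (hq : IntegrableOn q (Icc 0 ℓ)) (hq0 : ∀ t, 0 ≤ q t) :
    ∃ y z, IsSchrodingerSolution q ℓ y z ∧ y 0 = 0 ∧ z 0 = 1 ∧ ∀ t, 0 ≤ y t := by
  obtain ⟨y, hyc, hy0, hy⟩ := exists_volterra_solution (Q := (Icc 0 ℓ).indicator q)
    (hq.integrable_indicator measurableSet_Icc) (indicator_nonneg fun t _ => hq0 t)
  have hf : IntegrableOn (fun s => q s * y s) (Icc 0 ℓ) :=
    hq.mul_continuousOn hyc.continuousOn isCompact_Icc
  have hind : ∀ s, (Icc 0 ℓ).indicator q s * y s = (Icc 0 ℓ).indicator (fun s => q s * y s) s :=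
    fun s => by rw [indicator_mul_left]
  have hfi := hf.integrable_indicator measurableSet_Icc
  have hf0 : ∀ s < 0, (Icc 0 ℓ).indicator (fun s => q s * y s) s = 0 := fun s hs =>
    indicator_of_notMem (fun h => absurd h.1 (not_le.2 hs)) _
  simp only [hind] at hy
  have hval : ∀ t ∈ Icc 0 ℓ, ∫ s in Iio t, (Icc 0 ℓ).indicator (fun s => q s * y s) s =
      ∫ s in (0 : ℝ)..t, q s * y s := by
    intro t ht
    rw [setIntegral_indicator measurableSet_Icc, intervalIntegral.integral_of_le ht.1,
      integral_Ioc_eq_integral_Ioo, ← integral_Ico_eq_integral_Ioo]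
    congr 2
    ext s
    simp only [mem_inter_iff, mem_Iio, mem_Icc, mem_Ico]
    exact ⟨fun h => ⟨h.2.1, h.1⟩, fun h => ⟨h.2, h.1, (h.2.trans_le ht.2).le⟩⟩
  have hii : IntervalIntegrable (fun s => q s * y s) volume 0 ℓ :=
    (intervalIntegrable_iff_integrableOn_Icc_of_le hℓ.le).2 hf
  refine ⟨y, fun t => 1 + ∫ s in (0 : ℝ)..t, q s * y s, ⟨fun t ht => ?_, ?_, ?_⟩, ?_, by simp, hy0⟩
  · have h1 : HasDerivWithinAt (fun t => t + ∫ s, max (t - s) 0 *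
        (Icc 0 ℓ).indicator (fun s => q s * y s) s) (1 + ∫ s in (0 : ℝ)..t, q s * y s)
        (Icc 0 ℓ) t := by
      rw [← hval t ht]
      exact ((hasDerivAt_id t).add (hasDerivAt_integral_posPart_mul hfi hf0 t)).hasDerivWithinAt
    refine h1.congr (fun s hs => ?_) ?_
    · rw [hy s, max_eq_left hs.1]
    · rw [hy t, max_eq_left ht.1]
  · have h3 : AbsolutelyContinuousOnInterval (fun _ : ℝ => (1 : ℝ)) 0 ℓ :=
      ((LipschitzWith.const (1 : ℝ)).lipschitzOnWith (K := 0)).absolutelyContinuousOnInterval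
    exact h3.add (hii.absolutelyContinuousOnInterval_intervalIntegral (c := 0) (by simp))
  · filter_upwards [hii.ae_hasDerivAt_integral] with t ht hI
    refine (ht ?_ 0 (by simp)).const_add 1
    rw [uIcc_of_le hℓ.le]; exact Ioo_subset_Icc_self hI
  · rw [hy 0]
    simp only [max_self, zero_add]
    refine integral_eq_zero_of_ae (ae_of_all _ fun s => ?_)
    by_cases hs : s ∈ Icc 0 ℓ
    · simp [hs.1]
    · simp [indicator_of_notMem hs]

/-! ### Functions on a metric graph -/

namespace MetricGraph

variable {V : Type*} {G : MetricGraph V}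

theorem dartPoint_zero (d : G.graph.Dart) : G.dartPoint d 0 = G.vertexPoint d.fst := by
  unfold dartPoint
  rw [projIcc_left]
  exact Quot.sound (.start d)

theorem dartPoint_symm (d : G.graph.Dart) {t : ℝ} (ht : t ∈ Icc 0 (G.dartLength d)) :
    G.dartPoint d.symm (G.dartLength d - t) = G.dartPoint d t := by
  have ht' : G.dartLength d - t ∈ Icc 0 (G.dartLength d.symm) := by
    rw [dartLength_symm]; exact ⟨by linarith [ht.2], by linarith [ht.1]⟩
  unfold dartPoint
  rw [projIcc_of_mem _ ht, projIcc_of_mem _ ht']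
  exact (Quot.sound (.flip d _ _ rfl)).symm

theorem dartPoint_length (d : G.graph.Dart) :
    G.dartPoint d (G.dartLength d) = G.vertexPoint d.snd := by
  rw [← dartPoint_symm d (right_mem_Icc.2 (G.dartLength_pos d).le), sub_self, dartPoint_zero]
  rfl

theorem Point.cases {P : G.Point → Prop} (hv : ∀ v, P (G.vertexPoint v))
    (hd : ∀ d, ∀ t ∈ Icc 0 (G.dartLength d), P (G.dartPoint d t)) (p : G.Point) : P p := by
  induction p using Quot.ind with
  | mk p =>
    cases p with
    | vertex v => exact hv v
    | onDart d t =>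
      have := hd d t t.2
      unfold dartPoint at this
      rwa [projIcc_val] at this

/-- The function on the metric graph with vertex values `F` and edge values `g`. -/
def ofEdges (F : V → ℝ) (g : G.graph.Dart → ℝ → ℝ) (h0 : ∀ d, g d 0 = F d.fst)
    (hflip : ∀ d, ∀ t ∈ Icc 0 (G.dartLength d), g d.symm (G.dartLength d - t) = g d t) :
    G.Point → ℝ :=
  Quot.lift (fun p => match p with
    | .vertex v => F v
    | .onDart d t => g d t) (by
      rintro _ _ (⟨d⟩ | ⟨d, t, t', h⟩)
      · exact h0 d
      · simp only [h]; exact (hflip d t t.2).symm)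

section ofEdges

variable {F : V → ℝ} {g : G.graph.Dart → ℝ → ℝ} {h0 : ∀ d, g d 0 = F d.fst}
    {hflip : ∀ d, ∀ t ∈ Icc 0 (G.dartLength d), g d.symm (G.dartLength d - t) = g d t}

theorem ofEdges_dartPoint (d : G.graph.Dart) {t : ℝ} (ht : t ∈ Icc 0 (G.dartLength d)) :
    ofEdges F g h0 hflip (G.dartPoint d t) = g d t := by
  unfold dartPoint
  rw [projIcc_of_mem _ ht]
  rfl

end ofEdges

/-! ### Continuity for the geodesic distance -/

theorem edist_lt_iff {x y : G.Point} {r : ENNReal} :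
    edist x y < r ↔ ∃ L, G.HasPath x y L ∧ ENNReal.ofReal L < r := by
  change (⨅ (L : ℝ) (_ : G.HasPath x y L), ENNReal.ofReal L) < r ↔ _
  simp only [iInf_lt_iff, exists_prop]

theorem lipschitzOnWith_dartPoint (d : G.graph.Dart) :
    LipschitzOnWith 1 (G.dartPoint d) (Icc 0 (G.dartLength d)) := by
  intro s hs t ht
  have h := HasPath.step d s t hs ht (HasPath.refl (x := G.dartPoint d s))
  rw [zero_add] at h
  rw [ENNReal.coe_one, one_mul, edist_dist, Real.dist_eq, abs_sub_comm]
  exact iInf₂_le _ h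

theorem HasPath.abs_sub_le {f : G.Point → ℝ} {K : NNReal}
    (hf : ∀ d, LipschitzOnWith K (G.onDart f d) (Icc 0 (G.dartLength d))) {x y : G.Point} {L : ℝ}
    (h : G.HasPath x y L) : |f y - f x| ≤ K * L := by
  induction h with
  | refl => simp
  | step d s t hs ht h ih =>
    have h1 := (hf d).dist_le_mul t ht s hs
    rw [Real.dist_eq, Real.dist_eq] at h1
    have h2 := _root_.abs_sub_le (f (G.dartPoint d t)) (f (G.dartPoint d s)) (f x)
    unfold onDart at h1
    linarith

theorem uniformContinuous_of_lipschitzOnWith {f : G.Point → ℝ} {K : NNReal}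
    (hf : ∀ d, LipschitzOnWith K (G.onDart f d) (Icc 0 (G.dartLength d))) :
    UniformContinuous f := by
  rw [uniformity_basis_edist.uniformContinuous_iff Metric.uniformity_basis_dist]
  intro ε hε
  refine ⟨ENNReal.ofReal (ε / (K + 1)), ENNReal.ofReal_pos.2 (by positivity), fun x y hxy => ?_⟩
  obtain ⟨L, hL, hL'⟩ := edist_lt_iff.1 hxy
  have h1 := (ENNReal.ofReal_lt_ofReal_iff (by positivity)).1 hL'
  rw [lt_div_iff₀ (by positivity)] at h1
  have h2 := hL.abs_sub_le hf
  have h3 := hL.nonneg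
  simp only [mem_ofPred_eq, Real.dist_eq]
  rw [abs_sub_comm]
  nlinarith

/-- A function that is Lipschitz on each edge, and constant on all but finitely many edges, is
uniformly continuous. -/
theorem uniformContinuous_of_finite {f : G.Point → ℝ} {S : Set G.graph.Dart} (hS : S.Finite)
    (hf : ∀ d, ∃ K : NNReal, LipschitzOnWith K (G.onDart f d) (Icc 0 (G.dartLength d)))
    (hconst : ∀ d ∉ S, ∀ t ∈ Icc 0 (G.dartLength d),
      f (G.dartPoint d t) = f (G.vertexPoint d.fst)) :
    UniformContinuous f := by
  choose K hK using hf
  obtain ⟨K', hK'⟩ := (hS.image K).bddAbove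
  refine uniformContinuous_of_lipschitzOnWith (K := K') fun d => ?_
  by_cases hd : d ∈ S
  · exact (hK d).weaken (hK' (mem_image_of_mem K hd))
  · intro s hs t ht
    unfold onDart
    rw [hconst d hd s hs, hconst d hd t ht]
    simp

/-! ### The completion -/

open UniformSpace in
theorem coe_extension {f : G.Point → ℝ} (hf : UniformContinuous f) (p : G.Point) :
    Completion.extension f (p : G.Completion) = f p :=
  Completion.extension_coe hf p

theorem exists_bound_of_uniformContinuous [CompactSpace G.Completion] {f : G.Point → ℝ}
    (hf : UniformContinuous f) : ∃ M, ∀ p, |f p| ≤ M := by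
  obtain ⟨M, hM⟩ := isCompact_univ.exists_bound_of_continuousOn
    (UniformSpace.Completion.continuous_extension (f := f)).continuousOn
  refine ⟨M, fun p => ?_⟩
  have := hM (p : G.Completion) (mem_univ _)
  rwa [coe_extension hf] at this

theorem isCompact_edge (d : G.graph.Dart) :
    IsCompact ((fun t => (G.dartPoint d t : G.Completion)) '' Icc 0 (G.dartLength d)) :=
  isCompact_Icc.image_of_continuousOn
    ((UniformSpace.Completion.continuous_coe _).comp_continuousOn
      (lipschitzOnWith_dartPoint d).continuousOn)

/-- Away from the graph, a continuous function on the completion is determined by its values on all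
but finitely many edges. -/
theorem eq_of_eqOn_cofinite_edges (hdart : ∀ v, ∃ d : G.graph.Dart, d.fst = v)
    {S : Set G.graph.Dart} (hS : S.Finite) {x : G.Completion} (hx : x ∉ G.inCompletion)
    {f g : G.Completion → ℝ} (hf : ContinuousAt f x) (hg : ContinuousAt g x)
    (h : ∀ d ∉ S, ∀ t ∈ Icc 0 (G.dartLength d), f (G.dartPoint d t) = g (G.dartPoint d t)) :
    f x = g x := by
  have hK : IsClosed (⋃ d ∈ S,
      (fun t => (G.dartPoint d t : G.Completion)) '' Icc 0 (G.dartLength d)) :=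
    (hS.isCompact_biUnion fun d _ => isCompact_edge d).isClosed
  have hxK : x ∉ ⋃ d ∈ S,
      (fun t => (G.dartPoint d t : G.Completion)) '' Icc 0 (G.dartLength d) := by
    simp only [mem_iUnion, not_exists]
    rintro d - ⟨t, -, rfl⟩
    exact hx ⟨_, rfl⟩
  have hev := hK.isOpen_compl.mem_nhds hxK
  have : (Filter.comap ((↑) : G.Point → G.Completion) (nhds x)).NeBot :=
    UniformSpace.Completion.isDenseInducing_coe.comap_nhds_neBot x
  have ht : Filter.Tendsto ((↑) : G.Point → G.Completion)
      (Filter.comap ((↑) : G.Point → G.Completion) (nhds x)) (nhds x) := Filter.tendsto_comap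
  refine tendsto_nhds_unique_of_eventuallyEq (hf.tendsto.comp ht) (hg.tendsto.comp ht) ?_
  filter_upwards [ht hev] with p hp
  have key : ∀ d, ∀ t ∈ Icc 0 (G.dartLength d), p = G.dartPoint d t →
      f (p : G.Completion) = g (p : G.Completion) := by
    rintro d t ht rfl
    refine h d (fun hd => hp ?_) t ht
    exact mem_biUnion hd ⟨t, ht, rfl⟩
  induction p using Point.cases with
  | hv v =>
    obtain ⟨d, rfl⟩ := hdart v
    exact key d 0 (left_mem_Icc.2 (G.dartLength_pos d).le) (dartPoint_zero d).symm
  | hd d t ht => exact key d t ht rfl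

/-- A finite graph is compact, hence equal to its completion. -/
theorem infinite_of_notMem_inCompletion (hdart : ∀ v, ∃ d : G.graph.Dart, d.fst = v)
    {x : G.Completion} (hx : x ∉ G.inCompletion) : Infinite V := by
  by_contra hV
  rw [not_infinite_iff_finite] at hV
  have : Finite G.graph.Dart := Finite.of_injective _ SimpleGraph.Dart.toProd_injective
  exact zero_ne_one (eq_of_eqOn_cofinite_edges hdart (S := univ) (toFinite _) hx
    (f := fun _ => (0 : ℝ)) (g := fun _ => 1) continuousAt_const continuousAt_const
    fun d hd => absurd (mem_univ d) hd)

/-- No vertex is isolated: a graph that is a single point has no boundary. -/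
theorem exists_dart_fst_eq (hconn : G.graph.Connected) (hb : G.boundary.Nonempty) (v : V) :
    ∃ d : G.graph.Dart, d.fst = v := by
  rcases subsingleton_or_nontrivial V with hV | hV
  · exfalso
    have hp : ∀ p : G.Point, p = G.vertexPoint v := fun p => by
      induction p using Point.cases with
      | hv w => rw [Subsingleton.elim w v]
      | hd d t ht => exact absurd (Subsingleton.elim d.fst d.snd) d.fst_ne_snd
    obtain ⟨x, ⟨w, hw, -⟩ | hx⟩ := hb
    · obtain ⟨u, hu⟩ := (G.graph.degree_pos_iff_exists_adj w).1 (by omega)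
      exact hu.ne (Subsingleton.elim _ _)
    · have hcl : IsClosed (range ((↑) : G.Point → G.Completion)) := by
        refine Set.Subsingleton.isClosed ?_
        rintro _ ⟨p, rfl⟩ _ ⟨p', rfl⟩
        rw [hp p, hp p']
      have := UniformSpace.Completion.denseRange_coe.closure_range (α := G.Point)
      rw [hcl.closure_eq] at this
      exact hx ((Set.ext_iff.1 this x).2 (mem_univ x))
  · obtain ⟨w, hw⟩ := hconn.preconnected.exists_adj_of_nontrivial v
    exact ⟨⟨(v, w), hw⟩, rfl⟩

end MetricGraph

/-! ### Interpolation of vertex values -/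

namespace MetricGraph

variable {V : Type*} {G : MetricGraph V}

theorem sub_mem_Icc_dartLength_symm (d : G.graph.Dart) {t : ℝ} (ht : t ∈ Icc 0 (G.dartLength d)) :
    G.dartLength d - t ∈ Icc 0 (G.dartLength d.symm) := by
  rw [dartLength_symm]; exact ⟨by linarith [ht.2], by linarith [ht.1]⟩

variable (G) in
/-- A way of interpolating between vertex values: for each oriented edge, the interpolation of the
values `0` at its initial and `1` at its terminal vertex. It is Lipschitz and does not exceed the
linear interpolation. -/
structure EdgeProfile where
  toFun : G.graph.Dart → ℝ → ℝ
  map_zero : ∀ d, toFun d 0 = 0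
  map_length : ∀ d, toFun d (G.dartLength d) = 1
  nonneg : ∀ d, ∀ t ∈ Icc 0 (G.dartLength d), 0 ≤ toFun d t
  le_div : ∀ d, ∀ t ∈ Icc 0 (G.dartLength d), toFun d t ≤ t / G.dartLength d
  exists_lipschitz : ∀ d, ∃ K : NNReal, LipschitzOnWith K (toFun d) (Icc 0 (G.dartLength d))

namespace EdgeProfile

variable (G) in
/-- Linear interpolation. -/
noncomputable def linear : G.EdgeProfile where
  toFun d t := t / G.dartLength d
  map_zero d := zero_div _
  map_length d := div_self (G.dartLength_pos d).ne'
  nonneg d t ht := div_nonneg ht.1 (G.dartLength_pos d).le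
  le_div d t ht := le_rfl
  exists_lipschitz d := by
    refine ⟨‖(G.dartLength d)⁻¹‖₊, LipschitzOnWith.of_dist_le_mul fun s _ t _ => ?_⟩
    rw [Real.dist_eq, ← sub_div, div_eq_mul_inv, abs_mul, mul_comm]
    rfl

open Classical in
/-- The profile `a` on the edges in `T`, and linear interpolation on the other ones. -/
noncomputable def truncate (a : G.EdgeProfile) (T : Set (Sym2 V)) : G.EdgeProfile where
  toFun d := if d.edge ∈ T then a.toFun d else (linear G).toFun d
  map_zero d := by split_ifs <;> exact map_zero _ d
  map_length d := by split_ifs <;> exact map_length _ d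
  nonneg d := by split_ifs <;> exact nonneg _ d
  le_div d := by split_ifs <;> exact le_div _ d
  exists_lipschitz d := by split_ifs <;> exact exists_lipschitz _ d

variable (a : G.EdgeProfile) (F : V → ℝ)

/-- The function on the metric graph that interpolates the vertex values `F` along the edges. -/
def interp : G.Point → ℝ :=
  ofEdges F
    (fun d t => F d.snd * a.toFun d t + F d.fst * a.toFun d.symm (G.dartLength d - t))
    (fun d => by
      have := a.map_length d.symm
      rw [dartLength_symm] at this
      simp [a.map_zero, this])
    (fun d t ht => by
      rw [dartLength_symm, sub_sub_cancel, SimpleGraph.Dart.symm_symm, add_comm]; rfl)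

theorem interp_vertexPoint (v : V) : a.interp F (G.vertexPoint v) = F v := rfl

theorem interp_dartPoint (d : G.graph.Dart) {t : ℝ} (ht : t ∈ Icc 0 (G.dartLength d)) :
    a.interp F (G.dartPoint d t) =
      F d.snd * a.toFun d t + F d.fst * a.toFun d.symm (G.dartLength d - t) :=
  ofEdges_dartPoint d ht

theorem linear_interp_dartPoint (d : G.graph.Dart) {t : ℝ} (ht : t ∈ Icc 0 (G.dartLength d)) :
    (linear G).interp F (G.dartPoint d t) =
      F d.fst + (F d.snd - F d.fst) / G.dartLength d * t := by
  rw [interp_dartPoint _ _ d ht]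
  have := (G.dartLength_pos d).ne'
  simp only [linear, dartLength_symm]
  field_simp
  ring

theorem add_le_one (d : G.graph.Dart) {t : ℝ} (ht : t ∈ Icc 0 (G.dartLength d)) :
    a.toFun d t + a.toFun d.symm (G.dartLength d - t) ≤ 1 := by
  have h1 := a.le_div d t ht
  have h2 := a.le_div d.symm _ (sub_mem_Icc_dartLength_symm d ht)
  rw [dartLength_symm] at h2
  have h3 : t / G.dartLength d + (G.dartLength d - t) / G.dartLength d = 1 := by
    rw [← add_div, add_sub_cancel, div_self (G.dartLength_pos d).ne']
  linarith

theorem interp_sub (F' : V → ℝ) (p : G.Point) :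
    a.interp (F - F') p = a.interp F p - a.interp F' p := by
  induction p using Point.cases with
  | hv v => rfl
  | hd d t ht =>
    simp only [interp_dartPoint _ _ d ht, Pi.sub_apply]; ring

theorem abs_interp_le {M : ℝ} (hF : ∀ v, |F v| ≤ M) (p : G.Point) : |a.interp F p| ≤ M := by
  induction p using Point.cases with
  | hv v => exact hF v
  | hd d t ht =>
    have h1 := a.nonneg d t ht
    have h2 := a.nonneg d.symm _ (sub_mem_Icc_dartLength_symm d ht)
    have hM : 0 ≤ M := (abs_nonneg _).trans (hF d.fst)
    rw [interp_dartPoint _ _ d ht]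
    calc _ ≤ |F d.snd| * a.toFun d t + |F d.fst| * a.toFun d.symm (G.dartLength d - t) := by
          refine (abs_add_le _ _).trans_eq ?_
          rw [abs_mul, abs_mul, abs_of_nonneg h1, abs_of_nonneg h2]
      _ ≤ M * a.toFun d t + M * a.toFun d.symm (G.dartLength d - t) := by
          gcongr <;> exact hF _
      _ ≤ M := by
          rw [← mul_add]
          exact mul_le_of_le_one_right hM (a.add_le_one d ht)

theorem exists_lipschitzOnWith_interp (d : G.graph.Dart) :
    ∃ K : NNReal, LipschitzOnWith K (G.onDart (a.interp F) d) (Icc 0 (G.dartLength d)) := by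
  obtain ⟨K, hK⟩ := a.exists_lipschitz d
  obtain ⟨K', hK'⟩ := a.exists_lipschitz d.symm
  refine ⟨‖F d.snd‖₊ * K + ‖F d.fst‖₊ * K', LipschitzOnWith.of_dist_le_mul fun s hs t ht => ?_⟩
  have h1 := hK.dist_le_mul s hs t ht
  have h2 := hK'.dist_le_mul _ (sub_mem_Icc_dartLength_symm d hs) _
    (sub_mem_Icc_dartLength_symm d ht)
  rw [dist_sub_left] at h2
  unfold onDart
  rw [interp_dartPoint _ _ d hs, interp_dartPoint _ _ d ht]
  refine (dist_add_add_le _ _ _ _).trans ?_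
  simp only [Real.dist_eq, ← mul_sub, abs_mul] at h1 h2 ⊢
  push_cast
  rw [add_mul, mul_assoc, mul_assoc, Real.norm_eq_abs, Real.norm_eq_abs]
  gcongr

end EdgeProfile

/-! ### Finite sets of edges -/

theorem finite_setOf_edge_eq (e : Sym2 V) : {d : G.graph.Dart | d.edge = e}.Finite := by
  by_cases h : ∃ d : G.graph.Dart, d.edge = e
  · obtain ⟨d, rfl⟩ := h
    refine (toFinite {d, d.symm}).subset fun d' hd' => ?_
    exact SimpleGraph.dart_edge_eq_iff _ _ |>.1 hd'
  · exact finite_empty.subset fun d hd => h ⟨d, hd⟩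

theorem finite_setOf_edge_mem {T : Set (Sym2 V)} (hT : T.Finite) :
    {d : G.graph.Dart | d.edge ∈ T}.Finite :=
  (hT.biUnion fun e _ => finite_setOf_edge_eq e).subset fun _ hd => mem_biUnion hd rfl

variable (G) in
theorem finite_setOf_fst_eq (v : V) : {d : G.graph.Dart | d.fst = v}.Finite := by
  refine (finite_range (G.graph.dartOfNeighborSet v)).subset ?_
  rintro d rfl
  exact ⟨⟨d.snd, d.adj⟩, rfl⟩

variable (G) in
theorem finite_setOf_incident (v : V) : {d : G.graph.Dart | d.fst = v ∨ d.snd = v}.Finite := by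
  refine (finite_setOf_fst_eq G v).union ((finite_setOf_fst_eq G v).preimage
    (f := SimpleGraph.Dart.symm) SimpleGraph.Dart.symm_involutive.injective.injOn)

/-! ### Local bump functions -/

open Classical in
/-- The distance to the nearest end on the edges in `T`, and zero on the other edges. -/
noncomputable def tent (T : Set (Sym2 V)) : G.Point → ℝ :=
  ofEdges 0 (fun d t => if d.edge ∈ T then min t (G.dartLength d - t) else 0)
    (fun d => by simp [(G.dartLength_pos d).le])
    (fun d t ht => by
      simp only [SimpleGraph.Dart.edge_symm, dartLength_symm, sub_sub_cancel, min_comm])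

theorem tent_vertexPoint (T : Set (Sym2 V)) (v : V) : tent T (G.vertexPoint v) = 0 := rfl

open Classical in
theorem tent_dartPoint (T : Set (Sym2 V)) (d : G.graph.Dart) {t : ℝ}
    (ht : t ∈ Icc 0 (G.dartLength d)) :
    tent T (G.dartPoint d t) = if d.edge ∈ T then min t (G.dartLength d - t) else 0 :=
  ofEdges_dartPoint d ht

theorem uniformContinuous_tent (T : Set (Sym2 V)) : UniformContinuous (tent T : G.Point → ℝ) := by
  refine uniformContinuous_of_lipschitzOnWith (K := 1) fun d => ?_
  refine LipschitzOnWith.of_dist_le_mul fun s hs t ht => ?_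
  unfold onDart
  rw [tent_dartPoint T d hs, tent_dartPoint T d ht]
  split_ifs
  · rw [NNReal.coe_one, one_mul, Real.dist_eq, Real.dist_eq]
    refine (abs_min_sub_min_le_max _ _ _ _).trans (max_le le_rfl ?_)
    rw [sub_sub_sub_cancel_left, abs_sub_comm]
  · simp

/-- Compactness of the completion bounds the lengths of the edges. -/
theorem exists_dartLength_le [CompactSpace G.Completion] : ∃ B, ∀ d, G.dartLength d ≤ B := by
  obtain ⟨M, hM⟩ := exists_bound_of_uniformContinuous
    (uniformContinuous_tent (univ : Set (Sym2 V)) (G := G))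
  refine ⟨2 * M, fun d => ?_⟩
  have hd := G.dartLength_pos d
  have h1 := hM (G.dartPoint d (G.dartLength d / 2))
  rw [tent_dartPoint _ _ ⟨by positivity, by linarith⟩, if_pos (mem_univ _), sub_half, min_self,
    abs_of_pos (by positivity)] at h1
  linarith

/-- Each point of the metric graph has a bump function that lives on finitely many edges and that
vanishes at all other vertices. -/
theorem exists_bump (x : G.Point) : ∃ b : G.Point → ℝ, UniformContinuous b ∧ 0 < b x ∧
    (∃ S : Set G.graph.Dart, S.Finite ∧
      ∀ d ∉ S, ∀ t ∈ Icc 0 (G.dartLength d), b (G.dartPoint d t) = 0) ∧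
    ∀ v, b (G.vertexPoint v) ≠ 0 → x = G.vertexPoint v := by
  classical
  have hvert : ∀ v, ∃ b : G.Point → ℝ, UniformContinuous b ∧ 0 < b (G.vertexPoint v) ∧
      (∃ S : Set G.graph.Dart, S.Finite ∧
        ∀ d ∉ S, ∀ t ∈ Icc 0 (G.dartLength d), b (G.dartPoint d t) = 0) ∧
      ∀ w, b (G.vertexPoint w) ≠ 0 → G.vertexPoint v = G.vertexPoint w := by
    intro v
    have hS : ∀ d ∉ {d : G.graph.Dart | d.fst = v ∨ d.snd = v}, ∀ t ∈ Icc 0 (G.dartLength d),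
        (EdgeProfile.linear G).interp (Pi.single v 1) (G.dartPoint d t) = 0 := by
      intro d hd t ht
      rw [mem_ofPred_eq, not_or] at hd
      rw [EdgeProfile.interp_dartPoint _ _ d ht, Pi.single_eq_of_ne hd.1, Pi.single_eq_of_ne hd.2]
      simp
    refine ⟨(EdgeProfile.linear G).interp (Pi.single v 1),
      uniformContinuous_of_finite (finite_setOf_incident G v)
        (EdgeProfile.exists_lipschitzOnWith_interp _ _) fun d hd t ht => ?_,
      by simp [EdgeProfile.interp_vertexPoint], ⟨_, finite_setOf_incident G v, hS⟩, fun w hw => ?_⟩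
    · rw [hS d hd t ht, ← dartPoint_zero, hS d hd 0 (left_mem_Icc.2 (G.dartLength_pos d).le)]
    · rw [EdgeProfile.interp_vertexPoint] at hw
      by_contra h
      exact hw (Pi.single_eq_of_ne (fun h' => h (by rw [h'])) _)
  induction x using Point.cases with
  | hv v => exact hvert v
  | hd d t ht =>
    rcases ht.1.eq_or_lt with h0 | h0
    · rw [← h0, dartPoint_zero]; exact hvert _
    rcases ht.2.eq_or_lt with h1 | h1
    · rw [h1, dartPoint_length]; exact hvert _
    refine ⟨tent {d.edge}, uniformContinuous_tent _, ?_,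
      ⟨{d' | d'.edge = d.edge}, finite_setOf_edge_eq _, fun d' hd' t' ht' => ?_⟩,
      fun v hv => absurd (tent_vertexPoint _ v) hv⟩
    · rw [tent_dartPoint _ _ ht, if_pos (mem_singleton _)]
      exact lt_min h0 (by linarith)
    · rw [tent_dartPoint _ _ ht', if_neg (show d'.edge ∉ ({d.edge} : Set (Sym2 V)) from hd')]

/-- Only finitely many edges pass through a point. -/
theorem finite_setOf_mem_edge {x : G.Completion} (hx : x ∈ G.inCompletion) :
    {d : G.graph.Dart | ∃ t ∈ Icc 0 (G.dartLength d), (G.dartPoint d t : G.Completion) = x}.Finite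
    := by
  obtain ⟨p, rfl⟩ := hx
  obtain ⟨b, hb, hbp, ⟨S, hS, hbS⟩, -⟩ := exists_bump p
  refine hS.subset ?_
  rintro d ⟨t, ht, h⟩
  by_contra hd
  have h1 := congrArg (UniformSpace.Completion.extension b) h
  rw [coe_extension hb, coe_extension hb, hbS d hd t ht] at h1
  exact hbp.ne h1

/-- The boundary is closed, as bump functions vanish on it. -/
theorem isClosed_boundary (hdart : ∀ v, ∃ d : G.graph.Dart, d.fst = v) : IsClosed G.boundary := by
  rw [← isOpen_compl_iff, isOpen_iff_forall_mem_open]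
  intro y hy
  have hyG : y ∈ G.inCompletion := by
    by_contra h
    exact hy (Or.inr h)
  obtain ⟨p, rfl⟩ := hyG
  obtain ⟨b, hb, hbp, ⟨S, hS, hbS⟩, hbv⟩ := exists_bump p
  have hcont := UniformSpace.Completion.continuous_extension (f := b)
  refine ⟨{z | 0 < UniformSpace.Completion.extension b z}, ?_,
    isOpen_lt continuous_const hcont, by rwa [mem_ofPred_eq, coe_extension hb]⟩
  rintro z hz (⟨v, hv, rfl⟩ | hzG)
  · rw [mem_ofPred_eq, coe_extension hb] at hz
    exact hy (Or.inl ⟨v, hv, by rw [hbv v hz.ne']⟩)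
  · refine hz.ne' (eq_of_eqOn_cofinite_edges hdart hS hzG hcont.continuousAt
      (g := fun _ => (0 : ℝ)) continuousAt_const fun d hd t ht => ?_)
    rw [coe_extension hb, hbS d hd t ht]

end MetricGraph

/-! ### Extension to the completion -/

namespace MetricGraph

variable {V : Type*} {G : MetricGraph V}

/-- Values that are close on the graph are close on the completion. -/
theorem abs_extension_sub_le {f g : G.Point → ℝ} (hf : UniformContinuous f)
    (hg : UniformContinuous g) {δ : ℝ} (h : ∀ p, |f p - g p| ≤ δ) (x : G.Completion) :
    |UniformSpace.Completion.extension f x - UniformSpace.Completion.extension g x| ≤ δ := by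
  induction x using UniformSpace.Completion.induction_on with
  | hp =>
    exact isClosed_le ((UniformSpace.Completion.continuous_extension.sub
      UniformSpace.Completion.continuous_extension).abs) continuous_const
  | ih p => rw [coe_extension hf, coe_extension hg]; exact h p

theorem uniformContinuous_of_approx {f : G.Point → ℝ}
    (h : ∀ δ > 0, ∃ g : G.Point → ℝ, UniformContinuous g ∧ ∀ p, |f p - g p| ≤ δ) :
    UniformContinuous f := by
  refine uniformContinuous_of_uniform_approx_of_uniformContinuous fun u hu => ?_
  obtain ⟨ε, hε, hu⟩ := Metric.mem_uniformity_dist.1 hu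
  obtain ⟨g, hg, hfg⟩ := h (ε / 2) (half_pos hε)
  refine ⟨g, hg, fun p => hu ?_⟩
  rw [Real.dist_eq]
  linarith [hfg p]

namespace EdgeProfile

variable (a : G.EdgeProfile) {F : V → ℝ}

/-- Up to a uniformly small error, the profile is linear on all but finitely many edges. -/
def IsAsymptoticallyLinear : Prop :=
  ∀ ε > 0, {d : G.graph.Dart | ∃ t ∈ Icc 0 (G.dartLength d),
    ε < t / G.dartLength d - a.toFun d t}.Finite

theorem interp_truncate_of_notMem {T : Set (Sym2 V)} {d : G.graph.Dart} (hd : d.edge ∉ T)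
    (hF : F d.snd = F d.fst) {t : ℝ} (ht : t ∈ Icc 0 (G.dartLength d)) :
    (a.truncate T).interp F (G.dartPoint d t) = F d.fst := by
  have := (G.dartLength_pos d).ne'
  rw [interp_dartPoint _ _ d ht, hF]
  have hd' : d.symm.edge ∉ T := by rwa [SimpleGraph.Dart.edge_symm]
  simp only [truncate, if_neg hd, if_neg hd', linear, dartLength_symm]
  field_simp
  ring

theorem uniformContinuous_interp_truncate {T : Set (Sym2 V)} (hT : T.Finite)
    {S : Set G.graph.Dart} (hS : S.Finite) (hF : ∀ d ∉ S, F d.snd = F d.fst) :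
    UniformContinuous ((a.truncate T).interp F) := by
  refine uniformContinuous_of_finite (hS.union (finite_setOf_edge_mem hT))
    (exists_lipschitzOnWith_interp _ _) fun d hd t ht => ?_
  rw [mem_union, not_or] at hd
  rw [interp_truncate_of_notMem a (T := T) hd.2 (hF d hd.1) ht, interp_vertexPoint]

theorem abs_truncate_sub_le {T : Set (Sym2 V)} {ε : ℝ} (hε : 0 ≤ ε)
    (hT : ∀ d : G.graph.Dart, d.edge ∉ T → ∀ t ∈ Icc 0 (G.dartLength d),
      t / G.dartLength d - a.toFun d t ≤ ε) (d : G.graph.Dart) {t : ℝ}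
    (ht : t ∈ Icc 0 (G.dartLength d)) : |a.toFun d t - (a.truncate T).toFun d t| ≤ ε := by
  by_cases hd : d.edge ∈ T
  · simp [truncate, hd, hε]
  · have h1 := a.le_div d t ht
    have h2 := hT d hd t ht
    simp only [truncate, if_neg hd, linear]
    rw [abs_sub_comm, abs_of_nonneg (by linarith)]
    exact h2

/-- Interpolation by an asymptotically linear profile is a uniform limit of interpolations that are
linear on all but finitely many edges. -/
theorem exists_truncate_approx (ha : a.IsAsymptoticallyLinear) {M : ℝ} (hM : ∀ v, |F v| ≤ M)
    {δ : ℝ} (hδ : 0 < δ) : ∃ T : Set (Sym2 V), T.Finite ∧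
      ∀ p, |a.interp F p - (a.truncate T).interp F p| ≤ δ := by
  rcases isEmpty_or_nonempty V with hV | ⟨⟨v₀⟩⟩
  · refine ⟨∅, finite_empty, fun p => ?_⟩
    induction p using Point.cases with
    | hv v => exact isEmptyElim v
    | hd d t ht => exact isEmptyElim d.fst
  have hM0 : 0 ≤ M := (abs_nonneg _).trans (hM v₀)
  set ε := δ / (2 * M + 1) with hε
  have hε0 : 0 < ε := by positivity
  have hεδ : M * ε + M * ε ≤ δ := by
    have : (2 * M + 1) * ε = δ := by rw [hε]; field_simp
    linarith
  refine ⟨_, (ha ε hε0).image SimpleGraph.Dart.edge, fun p => ?_⟩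
  set T := SimpleGraph.Dart.edge '' {d : G.graph.Dart | ∃ t ∈ Icc 0 (G.dartLength d),
    ε < t / G.dartLength d - a.toFun d t} with hT
  have hTd : ∀ d : G.graph.Dart, d.edge ∉ T → ∀ t ∈ Icc 0 (G.dartLength d),
      t / G.dartLength d - a.toFun d t ≤ ε := by
    intro d hd t ht
    by_contra! h
    exact hd (mem_image_of_mem _ ⟨t, ht, h⟩)
  induction p using Point.cases with
  | hv v => rw [interp_vertexPoint, interp_vertexPoint]; simpa using hδ.le
  | hd d t ht =>
    have h1 := a.abs_truncate_sub_le hε0.le hTd d ht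
    have h2 := a.abs_truncate_sub_le hε0.le hTd d.symm (sub_mem_Icc_dartLength_symm d ht)
    rw [interp_dartPoint _ _ d ht, interp_dartPoint _ _ d ht, add_sub_add_comm, ← mul_sub,
      ← mul_sub]
    refine (abs_add_le _ _).trans ?_
    rw [abs_mul, abs_mul]
    refine le_trans ?_ hεδ
    gcongr <;> exact hM _

/-- The interpolation of bounded vertex values that agree at the ends of all but finitely many edges
is uniformly continuous. -/
theorem uniformContinuous_interp (ha : a.IsAsymptoticallyLinear) {M : ℝ} (hM : ∀ v, |F v| ≤ M)
    {S : Set G.graph.Dart} (hS : S.Finite) (hF : ∀ d ∉ S, F d.snd = F d.fst) :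
    UniformContinuous (a.interp F) :=
  uniformContinuous_of_approx fun δ hδ => by
    obtain ⟨T, hT, h⟩ := a.exists_truncate_approx ha hM hδ
    exact ⟨_, a.uniformContinuous_interp_truncate hT hS hF, h⟩

/-- If the vertex values are the values of `Φ`, and `Φ` is constant on edges, up to finitely many
exceptions, then the interpolation agrees with `Φ` outside the graph. -/
theorem extension_interp_eq (ha : a.IsAsymptoticallyLinear)
    (hdart : ∀ v, ∃ d : G.graph.Dart, d.fst = v) {M : ℝ} (hM : ∀ v, |F v| ≤ M)
    {S : Set G.graph.Dart} (hS : S.Finite) (hF : ∀ d ∉ S, F d.snd = F d.fst)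
    {x : G.Completion} (hx : x ∉ G.inCompletion) {Φ : G.Completion → ℝ} (hΦ : ContinuousAt Φ x)
    (hΦF : ∀ d ∉ S, ∀ t ∈ Icc 0 (G.dartLength d), Φ (G.dartPoint d t) = F d.fst) :
    UniformSpace.Completion.extension (a.interp F) x = Φ x := by
  refine eq_of_forall_dist_le fun δ hδ => ?_
  obtain ⟨T, hT, h⟩ := a.exists_truncate_approx ha hM hδ
  have hu := a.uniformContinuous_interp_truncate hT hS hF
  have h1 : UniformSpace.Completion.extension ((a.truncate T).interp F) x = Φ x := by
    refine eq_of_eqOn_cofinite_edges hdart (hS.union (finite_setOf_edge_mem hT)) hx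
      UniformSpace.Completion.continuous_extension.continuousAt hΦ fun d hd t ht => ?_
    rw [mem_union, not_or] at hd
    rw [coe_extension hu, hΦF d hd.1 t ht, interp_truncate_of_notMem a (T := T) hd.2 (hF d hd.1) ht]
  rw [← h1, Real.dist_eq]
  exact abs_extension_sub_le (a.uniformContinuous_interp ha hM hS hF) hu h x

end EdgeProfile

variable (G) in
theorem EdgeProfile.isAsymptoticallyLinear_linear : (EdgeProfile.linear G).IsAsymptoticallyLinear := by
  intro ε hε
  refine finite_empty.subset ?_
  rintro d ⟨t, ht, h⟩
  simp [EdgeProfile.linear] at h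
  linarith

/-! ### Separation of boundary points -/

variable (G) in
/-- The continuous functions on the completion that are constant on all but finitely many edges. -/
def eventuallyFlat : Subalgebra ℝ C(G.Completion, ℝ) where
  carrier := {Φ | ∃ S : Set G.graph.Dart, S.Finite ∧ ∀ d ∉ S, ∀ t ∈ Icc 0 (G.dartLength d),
    Φ (G.dartPoint d t) = Φ (G.vertexPoint d.fst)}
  mul_mem' := by
    rintro Φ Ψ ⟨S, hS, h⟩ ⟨S', hS', h'⟩
    refine ⟨S ∪ S', hS.union hS', fun d hd t ht => ?_⟩
    rw [mem_union, not_or] at hd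
    simp [h d hd.1 t ht, h' d hd.2 t ht]
  add_mem' := by
    rintro Φ Ψ ⟨S, hS, h⟩ ⟨S', hS', h'⟩
    refine ⟨S ∪ S', hS.union hS', fun d hd t ht => ?_⟩
    rw [mem_union, not_or] at hd
    simp [h d hd.1 t ht, h' d hd.2 t ht]
  algebraMap_mem' r := ⟨∅, finite_empty, fun d _ t _ => by simp⟩

/-- Weak connectedness says that the eventually flat functions separate the boundary points. -/
theorem exists_eventuallyFlat_ne (hweak : G.WeaklyConnected)
    (hdart : ∀ v, ∃ d : G.graph.Dart, d.fst = v) {x y : G.Completion}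
    (hx : x ∈ G.boundary) (hy : y ∈ G.boundary) (hxy : x ≠ y) :
    ∃ Φ ∈ G.eventuallyFlat, Φ x ≠ Φ y := by
  classical
  obtain ⟨W, hW, hWG, A, B, hA, hB, hAB, hWAB, hxA, hyB⟩ := hweak x y hxy
  -- `χ` is locally constant off `W`, hence constant on the edges that do not meet `W`
  set χ : G.Completion → ℝ := A.indicator 1 with hχ
  set F : V → ℝ := fun v => χ (G.vertexPoint v) with hFdef
  set S : Set G.graph.Dart := ⋃ w ∈ W, {d : G.graph.Dart | ∃ t ∈ Icc 0 (G.dartLength d),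
    (G.dartPoint d t : G.Completion) = w} with hS
  have hSfin : S.Finite := hW.biUnion fun w hw => finite_setOf_mem_edge (hWG hw)
  have hflat : ∀ d ∉ S, ∀ t ∈ Icc 0 (G.dartLength d), χ (G.dartPoint d t) = F d.fst := by
    intro d hd t ht
    set E := (fun t => (G.dartPoint d t : G.Completion)) '' Icc 0 (G.dartLength d) with hE
    have hEc : IsPreconnected E := isPreconnected_Icc.image _
      ((UniformSpace.Completion.continuous_coe _).comp_continuousOn
        (lipschitzOnWith_dartPoint d).continuousOn)
    have hEAB : E ⊆ A ∪ B := by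
      rw [← hWAB]
      rintro _ ⟨s, hs, rfl⟩ hsW
      exact hd (mem_biUnion hsW ⟨s, hs, rfl⟩)
    have h0 : (G.vertexPoint d.fst : G.Completion) ∈ E :=
      ⟨0, left_mem_Icc.2 (G.dartLength_pos d).le, by simp only [dartPoint_zero]⟩
    have h1 : (G.dartPoint d t : G.Completion) ∈ E := ⟨t, ht, rfl⟩
    simp only [hFdef, hχ]
    rcases IsPreconnected.subset_or_subset hA hB hAB hEAB hEc with h | h
    · rw [indicator_of_mem (h h0), indicator_of_mem (h h1)]; rfl
    · rw [indicator_of_notMem (disjoint_right.1 hAB (h h0)),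
        indicator_of_notMem (disjoint_right.1 hAB (h h1))]
  have hFS : ∀ d ∉ S, F d.snd = F d.fst := fun d hd => by
    rw [← hflat d hd _ (right_mem_Icc.2 (G.dartLength_pos d).le), dartPoint_length]
  have hM : ∀ v, |F v| ≤ 1 := fun v => by
    simp only [hFdef, hχ, indicator]; split_ifs <;> simp
  have hlin := EdgeProfile.isAsymptoticallyLinear_linear G
  have hu := (EdgeProfile.linear G).uniformContinuous_interp hlin hM hSfin hFS
  set Φ := UniformSpace.Completion.extension ((EdgeProfile.linear G).interp F) with hΦ
  have hval : ∀ z ∈ G.boundary, z ∈ A ∪ B → Φ z = χ z := by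
    rintro z (⟨v, -, rfl⟩ | hz) hzAB
    · rw [hΦ, coe_extension hu]; rfl
    · refine (EdgeProfile.linear G).extension_interp_eq hlin hdart hM hSfin hFS hz ?_ hflat
      rcases hzAB with h | h
      · refine (continuousAt_const (y := (1 : ℝ))).congr ?_
        filter_upwards [hA.mem_nhds h] with w hw
        simp [hχ, hw]
      · refine (continuousAt_const (y := (0 : ℝ))).congr ?_
        filter_upwards [hB.mem_nhds h] with w hw
        simp [hχ, disjoint_right.1 hAB hw]
  refine ⟨⟨Φ, UniformSpace.Completion.continuous_extension⟩, ⟨S, hSfin, fun d hd t ht => ?_⟩, ?_⟩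
  · change Φ _ = Φ _
    rw [hΦ, coe_extension hu, coe_extension hu, EdgeProfile.linear_interp_dartPoint _ d ht,
      hFS d hd, EdgeProfile.interp_vertexPoint]
    simp
  · change Φ x ≠ Φ y
    rw [hval x hx (Or.inl hxA), hval y hy (Or.inr hyB), hχ, indicator_of_mem hxA,
      indicator_of_notMem (disjoint_right.1 hAB hyB)]
    simp

end MetricGraph

namespace MetricGraph

variable {V : Type*} {G : MetricGraph V} {q : G.Point → ℝ}

/-! ### The maximum principle -/

theorem IsHarmonic.isSchrodingerSolution {u : G.Point → ℝ} (h : G.IsHarmonic q u)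
    (d : G.graph.Dart) : IsSchrodingerSolution (G.onDart q d) (G.dartLength d) (G.onDart u d)
      (G.derivOnDart u d) where
  hasDerivWithinAt t ht := (h.differentiableOn d t ht).hasDerivWithinAt
  absolutelyContinuous := h.absolutelyContinuous d
  equation := h.equation d

theorem derivOnDart_eq {u : G.Point → ℝ} {d : G.graph.Dart} {z Q : ℝ → ℝ}
    (h : IsSchrodingerSolution Q (G.dartLength d) (G.onDart u d) z) {t : ℝ}
    (ht : t ∈ Icc 0 (G.dartLength d)) : G.derivOnDart u d t = z t :=
  (h.hasDerivWithinAt t ht).derivWithin (uniqueDiffOn_Icc (G.dartLength_pos d) t ht)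

theorem isHarmonic_of_isSchrodingerSolution {u : G.Point → ℝ} {z : G.graph.Dart → ℝ → ℝ}
    (h : ∀ d, IsSchrodingerSolution (G.onDart q d) (G.dartLength d) (G.onDart u d) (z d))
    (hv : ∀ v, 2 ≤ G.graph.degree v →
      ∑ w : G.graph.neighborSet v, z (G.graph.dartOfNeighborSet v w) 0 = 0) :
    G.IsHarmonic q u where
  differentiableOn d t ht := ((h d).hasDerivWithinAt t ht).differentiableWithinAt
  absolutelyContinuous d := (h d).absolutelyContinuous.congr_eqOn fun t ht => by
    rw [uIcc_of_le (G.dartLength_pos d).le] at ht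
    rw [derivOnDart_eq (h d) ht]
  equation d := by
    filter_upwards [(h d).equation] with t ht hI
    refine (ht hI).congr_of_eventuallyEq ?_
    filter_upwards [Ioo_mem_nhds hI.1 hI.2] with s hs
    exact derivOnDart_eq (h d) (Ioo_subset_Icc_self hs)
  junction v hv2 := by
    refine Eq.trans ?_ (hv v hv2)
    exact Finset.sum_congr rfl fun w _ =>
      derivOnDart_eq (h _) (left_mem_Icc.2 (G.dartLength_pos _).le)

theorem IsHarmonic.sub {u u' : G.Point → ℝ} (h : G.IsHarmonic q u) (h' : G.IsHarmonic q u') :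
    G.IsHarmonic q (fun x => u x - u' x) := by
  refine isHarmonic_of_isSchrodingerSolution
    (z := fun d t => G.derivOnDart u d t - G.derivOnDart u' d t) (fun d => ?_) fun v hv => ?_
  · convert! (h.isSchrodingerSolution d).linearCombination (h'.isSchrodingerSolution d) 1 (-1)
      using 1
    · ext t; simp [onDart, sub_eq_add_neg]
    · ext t; simp [sub_eq_add_neg]
  · rw [Finset.sum_sub_distrib, h.junction v hv, h'.junction v hv, sub_zero]

/-- The square of a solution lies above its tangent at the left end. -/
theorem _root_.IsSchrodingerSolution.tangent_le_sq {Q y z : ℝ → ℝ} {ℓ : ℝ}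
    (h : IsSchrodingerSolution Q ℓ y z) (hℓ : 0 < ℓ) (hQ : ∀ t ∈ Icc 0 ℓ, 0 ≤ Q t) {t : ℝ}
    (ht : t ∈ Icc 0 ℓ) : y 0 ^ 2 + 2 * (y 0 * z 0) * t ≤ y t ^ 2 := by
  have hmono := h.monotoneOn_mul hℓ hQ
  have h0 : (0 : ℝ) ∈ Icc 0 ℓ := left_mem_Icc.2 hℓ.le
  have key := (convex_Icc 0 ℓ).mul_sub_le_image_sub_of_le_deriv (f := fun t => y t ^ 2)
    (h.continuousOn.pow 2) (C := 2 * (y 0 * z 0)) ?_ ?_ 0 h0 t ht ht.1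
  · linarith
  · rw [interior_Icc]
    exact fun s hs => ((h.hasDerivAt hs).fun_pow 2).differentiableAt.differentiableWithinAt
  · rw [interior_Icc]
    intro s hs
    rw [((h.hasDerivAt hs).fun_pow 2).deriv]
    have := hmono h0 (Ioo_subset_Icc_self hs) hs.1.le
    simp only at this
    simp only [Nat.cast_ofNat, Nat.add_one_sub_one, pow_one]
    linarith

/-- The square of a solution does not exceed the larger one of its values at the ends. -/
theorem _root_.IsSchrodingerSolution.sq_le_max {Q y z : ℝ → ℝ} {ℓ : ℝ}
    (h : IsSchrodingerSolution Q ℓ y z) (hℓ : 0 < ℓ) (hQ : ∀ t ∈ Icc 0 ℓ, 0 ≤ Q t) {t : ℝ}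
    (ht : t ∈ Icc 0 ℓ) : y t ^ 2 ≤ max (y 0 ^ 2) (y ℓ ^ 2) := by
  have hc : ConvexOn ℝ (Icc 0 ℓ) (fun t => y t ^ 2) := by
    refine convexOn_of_hasDerivWithinAt_monotoneOn (z := fun t => 2 * (y t * z t)) (fun s hs => ?_)
      (fun s hs t ht hst => mul_le_mul_of_nonneg_left (h.monotoneOn_mul hℓ hQ hs ht hst)
        two_pos.le)
    convert! (h.hasDerivWithinAt s hs).fun_pow 2 using 1
    simp; ring
  exact hc.le_max_of_mem_Icc (left_mem_Icc.2 hℓ.le) (right_mem_Icc.2 hℓ.le) ht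

/-- The maximum principle: the square of a `q`-harmonic function is convex on each edge and satisfies
the Kirchhoff condition, so that it cannot have an interior maximum unless it is constant. -/
theorem IsHarmonic.abs_le_of_boundary [CompactSpace G.Completion] (hconn : G.graph.Connected)
    (hb : G.boundary.Nonempty) (hq : ∀ x, 0 ≤ q x) {u : G.Completion → ℝ} (hu : Continuous u)
    (h : G.IsHarmonic q (fun x : G.Point => u x)) {M : ℝ} (hM : ∀ x ∈ G.boundary, |u x| ≤ M)
    (x : G.Completion) : |u x| ≤ M := by
  obtain ⟨x₀, hx₀⟩ := hb
  have hM0 : 0 ≤ M := (abs_nonneg _).trans (hM x₀ hx₀)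
  obtain ⟨y, -, hy⟩ := isCompact_univ.exists_isMaxOn ⟨x₀, mem_univ x₀⟩ (hu.pow 2).continuousOn
  set m := u y ^ 2 with hm
  have hle : ∀ x, u x ^ 2 ≤ m := fun x => hy (mem_univ x)
  by_contra! hx
  have hMm : M ^ 2 < m := lt_of_lt_of_le (by
    rw [← sq_abs (u x)]; exact pow_lt_pow_left₀ hx hM0 two_ne_zero) (hle x)
  have hbm : ∀ x ∈ G.boundary, u x ^ 2 < m := fun x hx =>
    ((sq_le_sq₀ (abs_nonneg _) hM0).2 (hM x hx)).trans_lt hMm |> fun h => by rwa [sq_abs] at h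
  set f : G.Point → ℝ := fun x => u x with hf
  have hsol := h.isSchrodingerSolution
  have hq' : ∀ d, ∀ t ∈ Icc 0 (G.dartLength d), 0 ≤ G.onDart q d t := fun d t _ => hq _
  have f0 : ∀ d, G.onDart f d 0 = f (G.vertexPoint d.fst) := fun d => by
    rw [onDart, dartPoint_zero]
  have fl : ∀ d, G.onDart f d (G.dartLength d) = f (G.vertexPoint d.snd) := fun d => by
    rw [onDart, dartPoint_length]
  -- the maximum is attained at a vertex
  have hA : ∃ v, f (G.vertexPoint v) ^ 2 = m := by
    have hyG : y ∈ G.inCompletion := by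
      by_contra hyG
      exact (hbm y (Or.inr hyG)).ne rfl
    obtain ⟨p, hp⟩ := hyG
    have hpm : f p ^ 2 = m := by simp only [hf, hp, hm]
    induction p using Point.cases with
    | hv v => exact ⟨v, hpm⟩
    | hd d t ht =>
      have h1 := (hsol d).sq_le_max (G.dartLength_pos d) (hq' d) ht
      rw [f0, fl] at h1
      rcases le_max_iff.1 h1 with h2 | h2
      · exact ⟨d.fst, le_antisymm (hle _) (hpm ▸ h2)⟩
      · exact ⟨d.snd, le_antisymm (hle _) (hpm ▸ h2)⟩
  -- all slopes at such a vertex are nonpositive and add up to zero, hence vanish; by convexity the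
  -- maximum is then attained on all edges at that vertex
  have hB : ∀ d : G.graph.Dart, f (G.vertexPoint d.fst) ^ 2 = m →
      ∀ t ∈ Icc 0 (G.dartLength d), f (G.dartPoint d t) ^ 2 = m := by
    intro d hd
    have hdeg : 2 ≤ G.graph.degree d.fst := by
      have h1 : 0 < G.graph.degree d.fst :=
        (G.graph.degree_pos_iff_exists_adj _).2 ⟨d.snd, d.adj⟩
      have h2 : G.graph.degree d.fst ≠ 1 := fun h1 => (hbm _ (Or.inl ⟨_, h1, rfl⟩)).ne hd
      omega
    have hle0 : ∀ d' : G.graph.Dart, d'.fst = d.fst →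
        f (G.vertexPoint d.fst) * G.derivOnDart f d' 0 ≤ 0 := by
      intro d' hd'
      have h1 := (hsol d').tangent_le_sq (G.dartLength_pos d') (hq' d')
        (right_mem_Icc.2 (G.dartLength_pos d').le)
      have h2 : G.onDart f d' (G.dartLength d') ^ 2 ≤ m := hle _
      rw [f0, hd'] at h1
      have h3 := G.dartLength_pos d'
      by_contra! h4
      nlinarith [mul_pos h4 h3]
    have hsum : ∑ w : G.graph.neighborSet d.fst, f (G.vertexPoint d.fst) *
        G.derivOnDart f (G.graph.dartOfNeighborSet d.fst w) 0 = 0 := by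
      rw [← Finset.mul_sum, h.junction _ hdeg, mul_zero]
    have h0 := (Finset.sum_eq_zero_iff_of_nonpos
      fun w _ => hle0 (G.graph.dartOfNeighborSet d.fst w) rfl).1 hsum
      (⟨d.snd, d.adj⟩ : G.graph.neighborSet d.fst) (Finset.mem_univ _)
    intro t ht
    have h1 := (hsol d).tangent_le_sq (G.dartLength_pos d) (hq' d) ht
    change f (G.vertexPoint d.fst) * G.derivOnDart f d 0 = 0 at h0
    rw [f0, h0, hd] at h1
    refine le_antisymm (hle _) ?_
    simpa [onDart] using h1
  obtain ⟨v₀, hv₀⟩ := hA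
  have hC : ∀ v, f (G.vertexPoint v) ^ 2 = m := by
    intro v
    obtain ⟨w⟩ := hconn.preconnected v₀ v
    induction w with
    | nil => exact hv₀
    | cons hadj w ih =>
      refine ih ?_
      have := hB ⟨(_, _), hadj⟩ hv₀ _ (right_mem_Icc.2 (G.dartLength_pos _).le)
      rwa [dartPoint_length] at this
  have hD : ∀ x, u x ^ 2 = m := by
    intro x
    induction x using UniformSpace.Completion.induction_on with
    | hp => exact isClosed_eq (hu.pow 2) continuous_const
    | ih p =>
      induction p using Point.cases with
      | hv v => exact hC v
      | hd d t ht => exact hB d (hC _) t ht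
  exact (hbm x₀ hx₀).ne (hD x₀)

end MetricGraph

namespace MetricGraph

variable {V : Type*} {G : MetricGraph V}

/-! ### Walks of bounded length -/

variable (G) in
/-- The total length of the edges of a walk. -/
def walkLength {v w : V} (p : G.graph.Walk v w) : ℝ := (p.darts.map G.dartLength).sum

theorem walkLength_nonneg {v w : V} (p : G.graph.Walk v w) : 0 ≤ G.walkLength p :=
  List.sum_nonneg fun x hx => by
    obtain ⟨d, -, rfl⟩ := List.mem_map.1 hx
    exact (G.dartLength_pos d).le

/-- If the completion is compact, then all vertices can be reached from a given one by walks of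
bounded length: the linear interpolation of the distance along walks is Lipschitz, hence bounded. -/
theorem exists_walkLength_le [CompactSpace G.Completion] (hconn : G.graph.Connected) (v₀ : V) :
    ∃ B, ∀ v, ∃ p : G.graph.Walk v₀ v, G.walkLength p ≤ B := by
  have hne : ∀ v, Nonempty (G.graph.Walk v₀ v) := fun v => hconn.preconnected v₀ v
  have hbdd : ∀ v, BddBelow (range fun p : G.graph.Walk v₀ v => G.walkLength p) := fun v =>
    ⟨0, by rintro _ ⟨p, rfl⟩; exact walkLength_nonneg p⟩
  -- the distance along walks; it changes by at most the length along an edge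
  set ρ : V → ℝ := fun v => ⨅ p : G.graph.Walk v₀ v, G.walkLength p with hρ
  have hstep : ∀ d : G.graph.Dart, ρ d.snd ≤ ρ d.fst + G.dartLength d := by
    intro d
    rw [← sub_le_iff_le_add]
    refine le_ciInf fun p => ?_
    rw [sub_le_iff_le_add]
    refine (ciInf_le (hbdd _) (p.concat d.adj)).trans_eq ?_
    simp only [walkLength, SimpleGraph.Walk.darts_concat, List.concat_eq_append, List.map_append,
      List.sum_append, List.map_cons, List.map_nil, List.sum_cons, List.sum_nil, add_zero]
  have hLip : UniformContinuous ((EdgeProfile.linear G).interp ρ) := by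
    refine uniformContinuous_of_lipschitzOnWith (K := 1) fun d => ?_
    refine LipschitzOnWith.of_dist_le_mul fun s hs t ht => ?_
    have h1 := hstep d
    have h2 := hstep d.symm
    rw [dartLength_symm] at h2
    change ρ d.fst ≤ ρ d.snd + _ at h2
    have h3 : |(ρ d.snd - ρ d.fst) / G.dartLength d| ≤ 1 := by
      rw [abs_div, abs_of_pos (G.dartLength_pos d), div_le_one (G.dartLength_pos d), abs_le]
      constructor <;> linarith
    unfold onDart
    rw [EdgeProfile.linear_interp_dartPoint _ d hs, EdgeProfile.linear_interp_dartPoint _ d ht,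
      dist_add_left, Real.dist_eq, Real.dist_eq, ← mul_sub, abs_mul]
    exact mul_le_mul_of_nonneg_right h3 (abs_nonneg _)
  obtain ⟨M, hM⟩ := exists_bound_of_uniformContinuous hLip
  refine ⟨M + 1, fun v => ?_⟩
  obtain ⟨p, hp⟩ := exists_lt_of_ciInf_lt (f := fun p : G.graph.Walk v₀ v => G.walkLength p)
    (a := M + 1) ((le_abs_self _).trans (hM (G.vertexPoint v)) |>.trans_lt (lt_add_one M))
  exact ⟨p, hp.le⟩

theorem abs_sub_le_sum_darts (f : V → ℝ) {v w : V} (p : G.graph.Walk v w) :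
    |f w - f v| ≤ (p.darts.map fun d => |f d.snd - f d.fst|).sum := by
  induction p with
  | nil => simp
  | cons h p ih =>
    simp only [SimpleGraph.Walk.darts_cons, List.map_cons, List.sum_cons]
    exact (_root_.abs_sub_le _ _ _).trans (by rw [add_comm]; gcongr)

/-- The Cauchy–Schwarz estimate of the oscillation of a function by its energy, along a simple path. -/
theorem sq_sub_le_energy {c : G.graph.Dart → ℝ} {κ : ℝ} (hκ : 0 < κ)
    (hc : ∀ d, κ ≤ c d * G.dartLength d) (f : V → ℝ) {v w : V} (p : G.graph.Walk v w) :
    ∃ s : Finset G.graph.Dart,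
      (f w - f v) ^ 2 ≤ G.walkLength p / κ * ∑ d ∈ s, c d * (f d.snd - f d.fst) ^ 2 := by
  classical
  have hc0 : ∀ d, 0 < c d := fun d =>
    pos_of_mul_pos_left (hκ.trans_le (hc d)) (G.dartLength_pos d).le
  have hnodup : p.bypass.darts.Nodup := List.Nodup.of_map _ p.bypass_isPath.isTrail.edges_nodup
  have hlen : G.walkLength p.bypass ≤ G.walkLength p := by
    refine List.Sublist.sum_le_sum ((p.darts_bypass_sublist_darts).map _) fun x hx => ?_
    obtain ⟨d, -, rfl⟩ := List.mem_map.1 hx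
    exact (G.dartLength_pos d).le
  refine ⟨p.bypass.darts.toFinset, ?_⟩
  have h1 := abs_sub_le_sum_darts f p.bypass
  rw [← List.sum_toFinset _ hnodup] at h1
  have h2 : G.walkLength p.bypass = ∑ d ∈ p.bypass.darts.toFinset, G.dartLength d :=
    (List.sum_toFinset _ hnodup).symm
  have hE : 0 ≤ ∑ d ∈ p.bypass.darts.toFinset, c d * (f d.snd - f d.fst) ^ 2 :=
    Finset.sum_nonneg fun d _ => mul_nonneg (hc0 d).le (sq_nonneg _)
  calc (f w - f v) ^ 2 = |f w - f v| ^ 2 := (sq_abs _).symm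
    _ ≤ (∑ d ∈ p.bypass.darts.toFinset, |f d.snd - f d.fst|) ^ 2 := by gcongr
    _ ≤ (∑ d ∈ p.bypass.darts.toFinset, 1 / c d) *
        ∑ d ∈ p.bypass.darts.toFinset, c d * (f d.snd - f d.fst) ^ 2 := by
      refine Finset.sum_sq_le_sum_mul_sum_of_sq_le_mul _ (fun d _ => (one_div_pos.2 (hc0 d)).le)
        (fun d _ => mul_nonneg (hc0 d).le (sq_nonneg _)) fun d _ => le_of_eq ?_
      rw [sq_abs, ← mul_assoc, one_div_mul_cancel (hc0 d).ne', one_mul]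
    _ ≤ _ := by
      refine mul_le_mul_of_nonneg_right ?_ hE
      refine le_trans ?_ (div_le_div_of_nonneg_right hlen hκ.le)
      rw [h2, Finset.sum_div]
      refine Finset.sum_le_sum fun d _ => ?_
      rw [div_le_div_iff₀ (hc0 d) hκ, one_mul, mul_comm]
      exact hc d

/-! ### The discrete Dirichlet problem -/

variable (G) in
/-- The bounded functions on the vertices that agree at the ends of all but finitely many edges. -/
def flatVertexFunctions : Submodule ℝ (V → ℝ) where
  carrier := {f | (∃ M, ∀ v, |f v| ≤ M) ∧ {d : G.graph.Dart | f d.snd ≠ f d.fst}.Finite}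
  zero_mem' := ⟨⟨0, by simp⟩, by simp⟩
  add_mem' := by
    rintro f g ⟨⟨M, hM⟩, hf⟩ ⟨⟨N, hN⟩, hg⟩
    refine ⟨⟨M + N, fun v => (abs_add_le _ _).trans (add_le_add (hM v) (hN v))⟩,
      (hf.union hg).subset fun d hd => ?_⟩
    by_contra h
    simp only [mem_union, mem_ofPred_eq, not_or, not_not] at h
    exact hd (by simp [h.1, h.2])
  smul_mem' := by
    rintro r f ⟨⟨M, hM⟩, hf⟩
    refine ⟨⟨|r| * M, fun v => ?_⟩, hf.subset fun d hd h => hd (by simp [h])⟩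
    rw [Pi.smul_apply, smul_eq_mul, abs_mul]
    exact mul_le_mul_of_nonneg_left (hM v) (abs_nonneg r)

variable (G) in
/-- The finitely supported functions on the vertices that vanish at the vertices of degree one. -/
def testFunctions : Submodule ℝ (V → ℝ) where
  carrier := {f | f.support.Finite ∧ ∀ v, G.graph.degree v = 1 → f v = 0}
  zero_mem' := ⟨by simp, by simp⟩
  add_mem' := by
    rintro f g ⟨hf, hf'⟩ ⟨hg, hg'⟩
    exact ⟨(hf.union hg).subset (Function.support_add f g), fun v hv => by simp [hf' v hv, hg' v hv]⟩
  smul_mem' := by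
    rintro r f ⟨hf, hf'⟩
    exact ⟨hf.subset (Function.support_const_smul_subset r f), fun v hv => by simp [hf' v hv]⟩

theorem testFunctions_le : G.testFunctions ≤ G.flatVertexFunctions := by
  rintro f ⟨hf, -⟩
  refine ⟨?_, ?_⟩
  · obtain ⟨M, hM⟩ := (hf.image fun v => |f v|).bddAbove
    refine ⟨max M 0, fun v => ?_⟩
    by_cases hv : f v = 0
    · simp [hv]
    · exact (hM ⟨v, hv, rfl⟩).trans (le_max_left _ _)
  · refine (hf.biUnion fun v _ => finite_setOf_incident G v).subset fun d hd => ?_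
    by_cases h1 : f d.fst = 0
    · exact mem_biUnion (x := d.snd) (fun h2 => hd (by rw [h2, h1])) (Or.inr rfl)
    · exact mem_biUnion (x := d.fst) h1 (Or.inl rfl)

section Energy

variable {c m : G.graph.Dart → ℝ}

/-- The weighted gradient of a function on the vertices. -/
noncomputable def gradient (c : G.graph.Dart → ℝ) :
    G.flatVertexFunctions →ₗ[ℝ] lp (fun _ : G.graph.Dart => ℝ) 2 where
  toFun f := ⟨fun d => √(c d) * (f.1 d.snd - f.1 d.fst), by
    refine memℓp_gen (summable_of_hasFiniteSupport (f.2.2.subset fun d hd h => hd ?_))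
    simp [h]⟩
  map_add' f g := by ext d; exact (by rw [add_sub_add_comm, mul_add] :
    √(c d) * ((f.1 d.snd + g.1 d.snd) - (f.1 d.fst + g.1 d.fst)) = _ + _)
  map_smul' r f := by ext d; simp; ring

/-- The weighted values of a function on the vertices. -/
noncomputable def weighted (hm : ∀ d, 0 ≤ m d) (hms : Summable m) :
    G.flatVertexFunctions →ₗ[ℝ] lp (fun _ : G.graph.Dart => ℝ) 2 where
  toFun f := ⟨fun d => √(2 * m d) * f.1 d.fst, by
    obtain ⟨M, hM⟩ := f.2.1
    refine memℓp_gen (Summable.of_nonneg_of_le (fun d => by positivity) (fun d => ?_)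
      (hms.mul_left (2 * M ^ 2)))
    simp only [Real.norm_eq_abs, ENNReal.toReal_ofNat, Real.rpow_ofNat, sq_abs, mul_pow]
    rw [Real.sq_sqrt (by have := hm d; positivity), ← sq_abs (f.1 d.fst)]
    have h1 : |f.1 d.fst| ^ 2 ≤ M ^ 2 := by gcongr; exact hM _
    nlinarith [hm d, mul_le_mul_of_nonneg_left h1 (hm d)]⟩
  map_add' f g := by ext d; exact mul_add _ _ _
  map_smul' r f := by ext d; simp; ring

/-- A function on the vertices, embedded in the Hilbert space whose norm is the energy norm. -/
noncomputable def energyMap (c : G.graph.Dart → ℝ) (hm : ∀ d, 0 ≤ m d) (hms : Summable m) :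
    G.flatVertexFunctions →ₗ[ℝ] WithLp 2 (lp (fun _ : G.graph.Dart => ℝ) 2 ×
      lp (fun _ : G.graph.Dart => ℝ) 2) :=
  (WithLp.linearEquiv 2 ℝ _).symm.toLinearMap ∘ₗ (gradient c).prod (weighted hm hms)

theorem sum_le_norm_energyMap (hc : ∀ d, 0 ≤ c d) (hm : ∀ d, 0 ≤ m d) (hms : Summable m)
    (f : G.flatVertexFunctions) (s : Finset G.graph.Dart) :
    ∑ d ∈ s, c d * (f.1 d.snd - f.1 d.fst) ^ 2 ≤ ‖energyMap c hm hms f‖ ^ 2 := by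
  have h1 := lp.sum_rpow_le_norm_rpow (p := 2) (by norm_num) (gradient c f) s
  simp only [ENNReal.toReal_ofNat, Real.rpow_ofNat] at h1
  rw [WithLp.prod_norm_sq_eq_of_L2]
  refine le_trans (le_of_eq ?_) (h1.trans (le_add_of_nonneg_right (sq_nonneg _)))
  refine Finset.sum_congr rfl fun d _ => ?_
  change _ = ‖√(c d) * (f.1 d.snd - f.1 d.fst)‖ ^ 2
  rw [Real.norm_eq_abs, sq_abs, mul_pow, Real.sq_sqrt (hc d)]

open Classical in
theorem summable_ite_fst (v : V) (B : G.graph.Dart → ℝ) :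
    Summable fun d : G.graph.Dart => if d.fst = v then B d else 0 :=
  summable_of_hasFiniteSupport ((finite_setOf_fst_eq G v).subset fun d hd => by
    by_contra h
    exact hd (if_neg h))

open Classical in
theorem tsum_ite_fst (v : V) (B : G.graph.Dart → ℝ) :
    ∑' d : G.graph.Dart, (if d.fst = v then B d else 0) =
      ∑ w : G.graph.neighborSet v, B (G.graph.dartOfNeighborSet v w) := by
  rw [← (G.graph.dartOfNeighborSet_injective v).tsum_eq, tsum_fintype]
  · exact Finset.sum_congr rfl fun w _ => if_pos rfl
  · intro d hd
    by_cases h : d.fst = v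
    · subst h; exact ⟨⟨d.snd, d.adj⟩, rfl⟩
    · exact absurd (if_neg h) hd

theorem tsum_dart_add_symm {B : G.graph.Dart → ℝ} (hB : Summable B) :
    ∑' d, (B d + B d.symm) = 2 * ∑' d, B d := by
  let e : G.graph.Dart ≃ G.graph.Dart :=
    Function.Involutive.toPerm _ SimpleGraph.Dart.symm_involutive
  have h1 : Summable fun d => B (e d) := e.summable_iff.2 hB
  have h2 : ∑' d, B (e d) = ∑' d, B d := e.tsum_eq B
  rw [two_mul]
  nth_rewrite 2 [← h2]
  exact hB.tsum_add h1

open Classical in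
theorem inner_gradient_single (hc : ∀ d, 0 ≤ c d) (hcs : ∀ d, c d.symm = c d)
    (f g : G.flatVertexFunctions) (v : V) (hg : g.1 = Pi.single v 1) :
    inner ℝ (gradient c g) (gradient c f) =
      2 * ∑ w : G.graph.neighborSet v, c (G.graph.dartOfNeighborSet v w) * (f.1 v - f.1 w) := by
  obtain ⟨B, hB⟩ : ∃ B : G.graph.Dart → ℝ,
    B = fun d => if d.fst = v then c d * (f.1 d.fst - f.1 d.snd) else 0 := ⟨_, rfl⟩
  have hBs : Summable B := hB ▸ summable_ite_fst v _
  have hterm : ∀ d, inner ℝ (gradient c g d) (gradient c f d) = B d + B d.symm := by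
    intro d
    change √(c d) * (f.1 d.snd - f.1 d.fst) * (√(c d) * (g.1 d.snd - g.1 d.fst)) = _
    have h2 := Real.mul_self_sqrt (hc d)
    have h3 : B d.symm = if d.snd = v then c d * (f.1 d.snd - f.1 d.fst) else 0 := by
      simp only [hB, hcs]; rfl
    rw [show √(c d) * (f.1 d.snd - f.1 d.fst) * (√(c d) * (g.1 d.snd - g.1 d.fst)) =
      c d * (f.1 d.snd - f.1 d.fst) * (g.1 d.snd - g.1 d.fst) by
        linear_combination (f.1 d.snd - f.1 d.fst) * (g.1 d.snd - g.1 d.fst) * h2,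
      h3, hg, Pi.single_apply, Pi.single_apply, hB]
    simp only
    split_ifs <;> ring
  rw [lp.inner_eq_tsum, tsum_congr hterm, tsum_dart_add_symm hBs, hB, tsum_ite_fst]
  rfl

open Classical in
theorem inner_weighted_single (hm : ∀ d, 0 ≤ m d) (hms : Summable m)
    (f g : G.flatVertexFunctions) (v : V) (hg : g.1 = Pi.single v 1) :
    inner ℝ (weighted hm hms g) (weighted hm hms f) =
      2 * ∑ w : G.graph.neighborSet v, m (G.graph.dartOfNeighborSet v w) * f.1 v := by
  have hterm : ∀ d, inner ℝ (weighted hm hms g d) (weighted hm hms f d) =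
      if d.fst = v then 2 * (m d * f.1 d.fst) else 0 := by
    intro d
    change √(2 * m d) * f.1 d.fst * (√(2 * m d) * g.1 d.fst) = _
    have h2 := Real.mul_self_sqrt (show 0 ≤ 2 * m d by have := hm d; positivity)
    rw [hg, Pi.single_apply]
    split_ifs
    · linear_combination f.1 d.fst * h2
    · ring
  rw [lp.inner_eq_tsum, tsum_congr hterm, tsum_ite_fst, ← Finset.mul_sum]
  rfl

open Classical in
/-- The energy inner product with the indicator function of a vertex is the discrete operator at that
vertex. -/
theorem inner_energyMap_single (hc : ∀ d, 0 ≤ c d) (hm : ∀ d, 0 ≤ m d) (hms : Summable m)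
    (hcs : ∀ d, c d.symm = c d) (f g : G.flatVertexFunctions) (v : V) (hg : g.1 = Pi.single v 1) :
    inner ℝ (energyMap c hm hms g) (energyMap c hm hms f) =
      2 * ∑ w : G.graph.neighborSet v,
        (c (G.graph.dartOfNeighborSet v w) * (f.1 v - f.1 w) +
          m (G.graph.dartOfNeighborSet v w) * f.1 v) := by
  rw [Finset.sum_add_distrib, mul_add, ← inner_gradient_single hc hcs f g v hg,
    ← inner_weighted_single hm hms f g v hg]
  exact WithLp.prod_inner_apply _ _

end Energy

end MetricGraph

namespace MetricGraph

variable {V : Type*} {G : MetricGraph V}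

/-- The energy norm controls the maximum of a test function: test functions vanish at some vertex, and
all vertices are joined by walks of bounded length. -/
theorem exists_abs_le_norm_energyMap [CompactSpace G.Completion] (hconn : G.graph.Connected)
    (hb : G.boundary.Nonempty) {c m : G.graph.Dart → ℝ} {κ : ℝ} (hκ : 0 < κ)
    (hc : ∀ d, κ ≤ c d * G.dartLength d) (hm : ∀ d, 0 ≤ m d) (hms : Summable m) :
    ∃ R, 0 ≤ R ∧ ∀ (f : G.flatVertexFunctions), f.1 ∈ G.testFunctions → ∀ v,
      |f.1 v| ≤ R * ‖energyMap c hm hms f‖ := by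
  have hc0 : ∀ d, 0 ≤ c d := fun d =>
    (pos_of_mul_pos_left (hκ.trans_le (hc d)) (G.dartLength_pos d).le).le
  obtain ⟨v₀⟩ := hconn.nonempty
  obtain ⟨B, hB⟩ := exists_walkLength_le hconn v₀
  have hB0 : 0 ≤ B := by
    obtain ⟨p, hp⟩ := hB v₀
    exact (walkLength_nonneg p).trans hp
  have hzero : ∀ f ∈ G.testFunctions, ∃ v, f v = 0 := by
    rintro f ⟨hf, hf'⟩
    obtain ⟨x, ⟨v, hv, -⟩ | hx⟩ := hb
    · exact ⟨v, hf' v hv⟩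
    · have := infinite_of_notMem_inCompletion (exists_dart_fst_eq hconn ⟨x, Or.inr hx⟩) hx
      obtain ⟨v, hv⟩ := hf.infinite_compl.nonempty
      exact ⟨v, by simpa using hv⟩
  have hosc : ∀ (f : G.flatVertexFunctions) v,
      |f.1 v - f.1 v₀| ≤ √(B / κ) * ‖energyMap c hm hms f‖ := by
    intro f v
    obtain ⟨p, hp⟩ := hB v
    obtain ⟨s, hs⟩ := sq_sub_le_energy hκ hc f.1 p
    refine abs_le_of_sq_le_sq ?_ (by positivity)
    rw [mul_pow, Real.sq_sqrt (by positivity)]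
    exact hs.trans (mul_le_mul (div_le_div_of_nonneg_right hp hκ.le)
      (sum_le_norm_energyMap hc0 hm hms f s)
      (Finset.sum_nonneg fun d _ => mul_nonneg (hc0 d) (sq_nonneg _)) (by positivity))
  refine ⟨2 * √(B / κ), by positivity, fun f hf v => ?_⟩
  obtain ⟨v₁, hv₁⟩ := hzero f.1 hf
  have h1 := hosc f v
  have h2 := hosc f v₁
  rw [hv₁, zero_sub, abs_neg] at h2
  have h3 := abs_sub_abs_le_abs_sub (f.1 v) (f.1 v₀)
  linarith

open Filter Topology in
/-- The discrete Dirichlet problem, solved by orthogonal projection in the energy space. The solution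
differs from the given function by a uniform limit of test functions. -/
theorem exists_discrete_solution [CompactSpace G.Completion] (hconn : G.graph.Connected)
    (hb : G.boundary.Nonempty) {c m : G.graph.Dart → ℝ} {κ : ℝ} (hκ : 0 < κ)
    (hc : ∀ d, κ ≤ c d * G.dartLength d) (hcs : ∀ d, c d.symm = c d) (hm : ∀ d, 0 ≤ m d)
    (hms : Summable m) {φ : V → ℝ} (hφ : φ ∈ G.flatVertexFunctions) :
    ∃ F : V → ℝ, (∀ ε > 0, ∃ f ∈ G.testFunctions, ∀ v, |F v - (φ v - f v)| ≤ ε) ∧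
      ∀ v, 2 ≤ G.graph.degree v → ∑ w : G.graph.neighborSet v,
        (c (G.graph.dartOfNeighborSet v w) * (F v - F w) +
          m (G.graph.dartOfNeighborSet v w) * F v) = 0 := by
  classical
  have hc0 : ∀ d, 0 ≤ c d := fun d =>
    (pos_of_mul_pos_left (hκ.trans_le (hc d)) (G.dartLength_pos d).le).le
  obtain ⟨R, hR0, hR⟩ := exists_abs_le_norm_energyMap hconn hb hκ hc hm hms
  set T := energyMap c hm hms with hT
  set N : Submodule ℝ G.flatVertexFunctions :=
    G.testFunctions.comap G.flatVertexFunctions.subtype with hN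
  set K := (N.map T).topologicalClosure with hK
  set a := T ⟨φ, hφ⟩ with ha
  have hPK : K.starProjection a ∈ closure (N.map T : Set _) := K.starProjection_apply_mem a
  obtain ⟨x, hxN, hx⟩ := mem_closure_iff_seq_limit.1 hPK
  choose f hfN hfx using hxN
  have hdiff : ∀ n k v, |(f n).1 v - (f k).1 v| ≤ R * ‖x n - x k‖ := by
    intro n k v
    have := hR (f n - f k) (N.sub_mem (hfN n) (hfN k)) v
    rwa [map_sub, hfx, hfx] at this
  have hcauchy : ∀ v, CauchySeq fun n => (f n).1 v := by
    intro v
    refine Metric.cauchySeq_iff.2 fun ε hε => ?_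
    obtain ⟨n₀, hn₀⟩ := Metric.cauchySeq_iff.1 hx.cauchySeq (ε / (R + 1)) (by positivity)
    refine ⟨n₀, fun n hn k hk => ?_⟩
    have h1 := hn₀ n hn k hk
    rw [dist_eq_norm, lt_div_iff₀ (by positivity)] at h1
    rw [Real.dist_eq]
    nlinarith [hdiff n k v, norm_nonneg (x n - x k)]
  choose g hg using fun v => cauchySeq_tendsto_of_complete (hcauchy v)
  have hunif : ∀ n v, |(f n).1 v - g v| ≤ R * ‖x n - K.starProjection a‖ := by
    intro n v
    exact le_of_tendsto_of_tendsto' ((tendsto_const_nhds.sub (hg v)).abs)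
      ((tendsto_const_nhds.sub hx).norm.const_mul R) fun k => hdiff n k v
  refine ⟨fun v => φ v - g v, fun ε hε => ?_, fun v hv => ?_⟩
  · obtain ⟨n, hn⟩ := ((Metric.tendsto_atTop.1 hx) (ε / (R + 1)) (by positivity))
    have h1 := hn n le_rfl
    rw [dist_eq_norm, lt_div_iff₀ (by positivity)] at h1
    refine ⟨(f n).1, hfN n, fun v => ?_⟩
    rw [sub_sub_sub_cancel_left]
    nlinarith [hunif n v, norm_nonneg (x n - K.starProjection a)]
  · have hδ : (Pi.single v 1 : V → ℝ) ∈ G.testFunctions := by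
      refine ⟨(finite_singleton v).subset Pi.support_single_subset, fun w hw => ?_⟩
      refine Pi.single_eq_of_ne (fun h => ?_) _
      subst h; omega
    set δ : G.flatVertexFunctions := ⟨Pi.single v 1, testFunctions_le hδ⟩ with hδdef
    have horth : inner ℝ (T δ) (a - K.starProjection a) = 0 :=
      (Submodule.mem_orthogonal _ _).1 (K.sub_starProjection_mem_orthogonal a) _
        (Submodule.le_topologicalClosure _ (Submodule.mem_map_of_mem (show δ ∈ N from hδ)))
    have hlim1 : Tendsto (fun n => inner ℝ (T δ) (a - x n)) atTop (𝓝 0) := by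
      rw [← horth]
      exact tendsto_const_nhds.inner (tendsto_const_nhds.sub hx)
    have hval : ∀ n, inner ℝ (T δ) (a - x n) = 2 * ∑ w : G.graph.neighborSet v,
        (c (G.graph.dartOfNeighborSet v w) * ((φ v - (f n).1 v) - (φ w - (f n).1 w)) +
          m (G.graph.dartOfNeighborSet v w) * (φ v - (f n).1 v)) := by
      intro n
      rw [ha, ← hfx n, ← map_sub]
      have h1 : δ.1 = Pi.single v 1 := rfl
      have h2 := inner_energyMap_single hc0 hm hms hcs (⟨φ, hφ⟩ - f n) δ v h1
      simp only [AddSubgroupClass.coe_sub, Pi.sub_apply] at h2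
      exact h2
    simp_rw [hval] at hlim1
    have hF : ∀ w, Tendsto (fun n => φ w - (f n).1 w) atTop (𝓝 (φ w - g w)) := fun w =>
      tendsto_const_nhds.sub (hg w)
    have hlim2 : Tendsto (fun n => 2 * ∑ w : G.graph.neighborSet v,
        (c (G.graph.dartOfNeighborSet v w) * ((φ v - (f n).1 v) - (φ w - (f n).1 w)) +
          m (G.graph.dartOfNeighborSet v w) * (φ v - (f n).1 v))) atTop
        (𝓝 (2 * ∑ w : G.graph.neighborSet v,
        (c (G.graph.dartOfNeighborSet v w) * ((φ v - g v) - (φ w - g w)) +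
          m (G.graph.dartOfNeighborSet v w) * (φ v - g v)))) := by
      refine Tendsto.const_mul 2 (tendsto_finsetSum _ fun w _ => ?_)
      exact (((hF v).sub (hF w)).const_mul _).add ((hF v).const_mul _)
    have := tendsto_nhds_unique hlim1 hlim2
    linarith

end MetricGraph

/-! ### The fundamental solution on an edge -/

/-- `y` is the solution of `y'' = q y` on `[0, ℓ]` with `y 0 = 0` and `y' 0 = 1`, for a nonnegative
integrable potential `q`. -/
structure IsFundamentalSolution (q : ℝ → ℝ) (ℓ : ℝ) (y z : ℝ → ℝ) : Prop extends
    IsSchrodingerSolution q ℓ y z where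
  length_pos : 0 < ℓ
  potential_nonneg : ∀ t, 0 ≤ q t
  potential_integrable : IntervalIntegrable q volume 0 ℓ
  map_zero : y 0 = 0
  deriv_zero : z 0 = 1
  nonneg : ∀ t, 0 ≤ y t

namespace IsFundamentalSolution

variable {q y z : ℝ → ℝ} {ℓ : ℝ}

theorem monotoneOn_z (h : IsFundamentalSolution q ℓ y z) : MonotoneOn z (Icc 0 ℓ) :=
  h.monotoneOn_deriv h.length_pos (fun t _ => h.potential_nonneg t) (fun t _ => h.nonneg t)

theorem left_mem (h : IsFundamentalSolution q ℓ y z) : (0 : ℝ) ∈ Icc 0 ℓ :=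
  left_mem_Icc.2 h.length_pos.le

theorem right_mem (h : IsFundamentalSolution q ℓ y z) : ℓ ∈ Icc 0 ℓ :=
  right_mem_Icc.2 h.length_pos.le

theorem one_le_deriv (h : IsFundamentalSolution q ℓ y z) {t : ℝ} (ht : t ∈ Icc 0 ℓ) : 1 ≤ z t :=
  h.deriv_zero ▸ h.monotoneOn_z h.left_mem ht ht.1

theorem sub_le_sub (h : IsFundamentalSolution q ℓ y z) {s t : ℝ} (hs : s ∈ Icc 0 ℓ)
    (ht : t ∈ Icc 0 ℓ) (hst : s ≤ t) : t - s ≤ y t - y s := by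
  have := (convex_Icc 0 ℓ).mul_sub_le_image_sub_of_le_deriv h.continuousOn (C := 1)
    (by rw [interior_Icc]
        exact fun r hr => (h.hasDerivAt hr).differentiableAt.differentiableWithinAt)
    (by rw [interior_Icc]
        exact fun r hr => (h.hasDerivAt hr).deriv ▸ h.one_le_deriv (Ioo_subset_Icc_self hr))
    s hs t ht hst
  linarith

theorem le_self (h : IsFundamentalSolution q ℓ y z) {t : ℝ} (ht : t ∈ Icc 0 ℓ) : t ≤ y t := by
  have := h.sub_le_sub h.left_mem ht ht.1
  rw [h.map_zero] at this
  linarith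

theorem pos (h : IsFundamentalSolution q ℓ y z) : 0 < y ℓ :=
  h.length_pos.trans_le (h.le_self h.right_mem)

theorem le_right (h : IsFundamentalSolution q ℓ y z) {t : ℝ} (ht : t ∈ Icc 0 ℓ) : y t ≤ y ℓ := by
  have := h.sub_le_sub ht h.right_mem ht.2
  linarith [ht.2]

/-- The fundamental solution is convex, hence lies below its chord. -/
theorem div_le_div (h : IsFundamentalSolution q ℓ y z) {t : ℝ} (ht : t ∈ Icc 0 ℓ) :
    y t / y ℓ ≤ t / ℓ := by
  have hc := convexOn_of_hasDerivWithinAt_monotoneOn h.hasDerivWithinAt h.monotoneOn_z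
  have hℓ := h.length_pos
  have h1 := hc.2 h.left_mem h.right_mem
    (show 0 ≤ 1 - t / ℓ by rw [sub_nonneg, div_le_one hℓ]; exact ht.2)
    (show 0 ≤ t / ℓ from div_nonneg ht.1 hℓ.le) (by ring)
  simp only [smul_eq_mul, mul_zero, zero_add, h.map_zero, div_mul_cancel₀ _ hℓ.ne'] at h1
  rwa [div_le_iff₀ h.pos]

theorem deriv_sub_one_le (h : IsFundamentalSolution q ℓ y z) :
    z ℓ - 1 ≤ (∫ t in (0 : ℝ)..ℓ, q t) * y ℓ := by
  have h1 := h.integral_eq_sub h.length_pos le_rfl h.length_pos.le le_rfl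
  rw [h.deriv_zero] at h1
  rw [← h1, ← intervalIntegral.integral_mul_const]
  refine intervalIntegral.integral_mono_on h.length_pos.le (h.intervalIntegrable h.length_pos)
    (h.potential_integrable.mul_const _) fun t ht => ?_
  exact mul_le_mul_of_nonneg_left (h.le_right ht) (h.potential_nonneg t)

theorem right_le (h : IsFundamentalSolution q ℓ y z) :
    y ℓ ≤ ℓ + ℓ * (∫ t in (0 : ℝ)..ℓ, q t) * y ℓ := by
  have h1 := (convex_Icc 0 ℓ).image_sub_le_mul_sub_of_deriv_le h.continuousOn (C := z ℓ)
    (by rw [interior_Icc]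
        exact fun r hr => (h.hasDerivAt hr).differentiableAt.differentiableWithinAt)
    (by rw [interior_Icc]
        exact fun r hr => (h.hasDerivAt hr).deriv ▸
          h.monotoneOn_z (Ioo_subset_Icc_self hr) h.right_mem hr.2.le)
    0 h.left_mem ℓ h.right_mem h.length_pos.le
  rw [h.map_zero] at h1
  nlinarith [mul_le_mul_of_nonneg_left h.deriv_sub_one_le h.length_pos.le]

/-- A potential with small integral hardly bends the solution. -/
theorem div_sub_div_le (h : IsFundamentalSolution q ℓ y z) {t : ℝ} (ht : t ∈ Icc 0 ℓ) :
    t / ℓ - y t / y ℓ ≤ ℓ * ∫ t in (0 : ℝ)..ℓ, q t := by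
  have hℓ := h.length_pos
  have hp := h.pos
  have h1 : t / y ℓ ≤ y t / y ℓ := div_le_div_of_nonneg_right (h.le_self ht) hp.le
  have h2 : t / ℓ - t / y ℓ = t / ℓ * ((y ℓ - ℓ) / y ℓ) := by field_simp
  have h3 : (y ℓ - ℓ) / y ℓ ≤ ℓ * ∫ t in (0 : ℝ)..ℓ, q t := by
    rw [div_le_iff₀ hp]; linarith [h.right_le]
  have h4 : 0 ≤ (y ℓ - ℓ) / y ℓ := div_nonneg (sub_nonneg.2 (h.le_self h.right_mem)) hp.le
  have h5 : t / ℓ ≤ 1 := (div_le_one hℓ).2 ht.2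
  nlinarith

end IsFundamentalSolution

namespace MetricGraph

variable {V : Type*} {G : MetricGraph V} {q : G.Point → ℝ}

theorem onDart_symm (f : G.Point → ℝ) (d : G.graph.Dart) {t : ℝ} (ht : t ∈ Icc 0 (G.dartLength d)) :
    G.onDart f d.symm (G.dartLength d - t) = G.onDart f d t := by
  rw [onDart, dartPoint_symm d ht, onDart]

/-- A solution along the reversed edge, read along the edge. -/
theorem _root_.IsSchrodingerSolution.of_symm {d : G.graph.Dart} {y z : ℝ → ℝ}
    (h : IsSchrodingerSolution (G.onDart q d.symm) (G.dartLength d.symm) y z) :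
    IsSchrodingerSolution (G.onDart q d) (G.dartLength d) (fun t => y (G.dartLength d - t))
      (fun t => -z (G.dartLength d - t)) := by
  rw [dartLength_symm] at h
  exact (h.reflect (G.dartLength_pos d)).congr_potential fun t ht => onDart_symm q d ht

variable (q) in
/-- The integral of the potential over an edge. -/
noncomputable def potentialIntegral (d : G.graph.Dart) : ℝ :=
  ∫ t in (0 : ℝ)..G.dartLength d, G.onDart q d t

theorem potentialIntegral_symm (d : G.graph.Dart) :
    potentialIntegral q d.symm = potentialIntegral q d := by
  unfold potentialIntegral
  rw [dartLength_symm]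
  calc ∫ t in (0 : ℝ)..G.dartLength d, G.onDart q d.symm t
      = ∫ t in (0 : ℝ)..G.dartLength d, G.onDart q d (G.dartLength d - t) := by
        refine intervalIntegral.integral_congr fun t ht => ?_
        rw [uIcc_of_le (G.dartLength_pos d).le] at ht
        have := onDart_symm q d (t := G.dartLength d - t) ⟨by linarith [ht.2], by linarith [ht.1]⟩
        rwa [sub_sub_cancel] at this
    _ = ∫ t in (0 : ℝ)..G.dartLength d, G.onDart q d t := by
        simp [intervalIntegral.integral_comp_sub_left]

theorem potentialIntegral_nonneg (hq : ∀ x, 0 ≤ q x) (d : G.graph.Dart) :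
    0 ≤ potentialIntegral q d :=
  intervalIntegral.integral_nonneg (G.dartLength_pos d).le fun _ _ => hq _

theorem orient_injective : Function.Injective G.orient := fun e e' h => Subtype.ext (by
  rw [← (G.exists_dart e).choose_spec, ← (G.exists_dart e').choose_spec]
  exact congrArg SimpleGraph.Dart.edge h)

theorem orient_edge (e : G.graph.edgeSet) : (G.orient e).edge = e := (G.exists_dart e).choose_spec

theorem dartLength_orient (e : G.graph.edgeSet) : G.dartLength (G.orient e) = G.length e := by
  unfold dartLength
  congr 1
  exact Subtype.ext (orient_edge e)

/-- A function of the edges is summable over the oriented edges if it is summable over the edges. -/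
theorem summable_dart {I : G.graph.Dart → ℝ} (hI : ∀ d, I d.symm = I d) (hI0 : ∀ d, 0 ≤ I d)
    (h : Summable fun e => I (G.orient e)) : Summable I := by
  classical
  set A : G.graph.Dart → ℝ := (range G.orient).indicator I with hA
  have hAs : Summable A := by
    refine (orient_injective.summable_iff fun d hd => indicator_of_notMem hd _).1 ?_
    convert! h using 1
    ext e
    exact indicator_of_mem (mem_range_self e) _
  have hA0 : ∀ d, 0 ≤ A d := fun d => indicator_nonneg (fun d _ => hI0 d) d
  have hAs' : Summable fun d => A (SimpleGraph.Dart.symm d) :=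
    hAs.comp_injective SimpleGraph.Dart.symm_involutive.injective
  refine Summable.of_nonneg_of_le hI0 (fun d => ?_) (hAs.add hAs')
  rcases (SimpleGraph.dart_edge_eq_iff d (G.orient ⟨d.edge, d.edge_mem⟩)).1
    (orient_edge ⟨d.edge, d.edge_mem⟩).symm with h' | h'
  · have : A d = I d := indicator_of_mem (show d ∈ range G.orient from ⟨_, h'.symm⟩) I
    linarith [hA0 d.symm]
  · have h'' : d.symm = G.orient ⟨d.edge, d.edge_mem⟩ := by
      rw [← SimpleGraph.Dart.symm_symm (G.orient ⟨d.edge, d.edge_mem⟩), ← h']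
    have : A d.symm = I d := (indicator_of_mem (show d.symm ∈ range G.orient from ⟨_, h''.symm⟩) I).trans (hI d)
    linarith [hA0 d]

/-- The weight `ω` makes the potential integrable over the whole graph, as `q ≤ ω⁻¹ q² + ω`. -/
theorem summable_potentialIntegral [CompactSpace G.Completion] (hq : ∀ x, 0 ≤ q x)
    (hq_loc : G.LocallyIntegrable q) {ω : G.graph.edgeSet → ℝ} (hω_pos : ∀ e, 0 < ω e)
    (hω_sum : Summable ω)
    (hqω : ∑' e, G.edgeIntegral (fun x => ENNReal.ofReal (((ω e)⁻¹ * q x) ^ 2 * ω e)) e < ⊤) :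
    Summable (potentialIntegral q : G.graph.Dart → ℝ) := by
  refine summable_dart potentialIntegral_symm (potentialIntegral_nonneg hq) ?_
  obtain ⟨B, hB⟩ := exists_dartLength_le (G := G)
  have hJ := ENNReal.summable_toReal hqω.ne
  refine Summable.of_nonneg_of_le (fun e => potentialIntegral_nonneg hq _) (fun e => ?_)
    (hJ.add (hω_sum.mul_right B))
  have hJe := ENNReal.ne_top_of_tsum_ne_top hqω.ne e
  set J := G.edgeIntegral (fun x => ENNReal.ofReal (((ω e)⁻¹ * q x) ^ 2 * ω e)) e with hJdef
  set d := G.orient e with hd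
  have hℓ := G.dartLength_pos d
  have hωe := hω_pos e
  have h1 : ENNReal.ofReal (potentialIntegral q d) ≤ J + ENNReal.ofReal (ω e * G.dartLength d) := by
    unfold potentialIntegral
    rw [intervalIntegral.integral_of_le hℓ.le, ← integral_Icc_eq_integral_Ioc,
      ofReal_integral_eq_lintegral_ofReal (hq_loc d) (ae_of_all _ fun t => hq _)]
    calc ∫⁻ t in Icc 0 (G.dartLength d), ENNReal.ofReal (G.onDart q d t)
        ≤ ∫⁻ t in Icc 0 (G.dartLength d),
          (ENNReal.ofReal (((ω e)⁻¹ * q (G.dartPoint d t)) ^ 2 * ω e) + ENNReal.ofReal (ω e)) := by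
          refine lintegral_mono fun t => ?_
          rw [← ENNReal.ofReal_add (by positivity) hωe.le]
          refine ENNReal.ofReal_le_ofReal ?_
          unfold onDart
          have h2 : ω e * ((ω e)⁻¹ * q (G.dartPoint d t)) = q (G.dartPoint d t) :=
            mul_inv_cancel_left₀ hωe.ne' _
          nlinarith [mul_nonneg hωe.le (sq_nonneg ((ω e)⁻¹ * q (G.dartPoint d t) - 1)),
            hq (G.dartPoint d t)]
      _ = J + ENNReal.ofReal (ω e * G.dartLength d) := by
          rw [lintegral_add_right _ measurable_const, setLIntegral_const, Real.volume_Icc, sub_zero,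
            ENNReal.ofReal_mul hωe.le, hJdef, edgeIntegral, ← dartLength_orient e]
  have h2 : ω e * G.dartLength d ≤ ω e * B := mul_le_mul_of_nonneg_left (hB d) hωe.le
  have h3 := (ENNReal.ofReal_le_iff_le_toReal (ENNReal.add_ne_top.2
    ⟨hJe, ENNReal.ofReal_ne_top⟩)).1 h1
  rw [ENNReal.toReal_add hJe ENNReal.ofReal_ne_top,
    ENNReal.toReal_ofReal (mul_pos hωe hℓ).le] at h3
  linarith

/-- The reduction to a discrete network. Interpolating by solutions of `u'' = q u`, one obtains a
`q`-harmonic function exactly if the vertex values solve a discrete Schrödinger equation with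
conductances `c` and nonnegative summable potential `m`. -/
theorem exists_edgeProfile [CompactSpace G.Completion] (hq : ∀ x, 0 ≤ q x)
    (hq_loc : G.LocallyIntegrable q)
    (hsum : Summable (potentialIntegral q : G.graph.Dart → ℝ)) :
    ∃ (a : G.EdgeProfile) (c m : G.graph.Dart → ℝ) (κ : ℝ), a.IsAsymptoticallyLinear ∧ 0 < κ ∧
      (∀ d, κ ≤ c d * G.dartLength d) ∧ (∀ d, c d.symm = c d) ∧ (∀ d, 0 ≤ m d) ∧ Summable m ∧
      ∀ F : V → ℝ, (∀ v, 2 ≤ G.graph.degree v → ∑ w : G.graph.neighborSet v,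
        (c (G.graph.dartOfNeighborSet v w) * (F v - F w) +
          m (G.graph.dartOfNeighborSet v w) * F v) = 0) → G.IsHarmonic q (a.interp F) := by
  have hex : ∀ d : G.graph.Dart, ∃ y z : ℝ → ℝ,
      IsFundamentalSolution (G.onDart q d) (G.dartLength d) y z := fun d => by
    obtain ⟨y, z, h, h0, h1, h2⟩ := exists_isSchrodingerSolution (G.dartLength_pos d) (hq_loc d)
      fun t => hq _
    exact ⟨y, z, h, G.dartLength_pos d, fun t => hq _,
      (intervalIntegrable_iff_integrableOn_Icc_of_le (G.dartLength_pos d).le).2 (hq_loc d),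
      h0, h1, h2⟩
  choose y z h using hex
  obtain ⟨B, hB⟩ := exists_dartLength_le (G := G)
  -- compare the Wronskian of the fundamental solutions from the two ends, at the two ends
  have hsymm : ∀ d, y d.symm (G.dartLength d) = y d (G.dartLength d) := fun d => by
    have h1 := (h d).wronskian (h d.symm).toIsSchrodingerSolution.of_symm (G.dartLength_pos d)
    simp only [sub_zero, sub_self, (h d).map_zero, (h d).deriv_zero, (h d.symm).map_zero,
      (h d.symm).deriv_zero] at h1
    linarith
  have hpos : ∀ d, 0 < y d (G.dartLength d) := fun d => (h d).pos
  have hsmall : ∀ ε > 0, {d : G.graph.Dart | ε < G.dartLength d * potentialIntegral q d}.Finite := by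
    intro ε hε
    have h1 := (hsum.mul_left B).tendsto_cofinite_zero.eventually (gt_mem_nhds hε)
    refine (Filter.eventually_cofinite.1 h1).subset fun d hd h2 => ?_
    have h3 : G.dartLength d * potentialIntegral q d ≤ B * potentialIntegral q d :=
      mul_le_mul_of_nonneg_right (hB d) (potentialIntegral_nonneg hq d)
    exact (lt_irrefl _ (hd.trans (h3.trans_lt h2)))
  let a : G.EdgeProfile :=
    { toFun := fun d t => y d t / y d (G.dartLength d)
      map_zero := fun d => by rw [(h d).map_zero, zero_div]
      map_length := fun d => div_self (hpos d).ne'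
      nonneg := fun d t _ => div_nonneg ((h d).nonneg t) (hpos d).le
      le_div := fun d t ht => (h d).div_le_div ht
      exists_lipschitz := fun d => by
        have h1 := (h d).linearCombination (h d).toIsSchrodingerSolution (y d (G.dartLength d))⁻¹ 0
        obtain ⟨K, hK⟩ := h1.exists_lipschitz (G.dartLength_pos d)
        refine ⟨K, fun s hs t ht => ?_⟩
        simpa only [div_eq_inv_mul, zero_mul, add_zero] using hK hs ht }
  set c : G.graph.Dart → ℝ := fun d => 1 / y d (G.dartLength d) with hc
  -- `c + m` is minus the slope at `d.fst` of the interpolation of the values `1` there, `0` at `d.snd`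
  set m : G.graph.Dart → ℝ := fun d =>
    (z d.symm (G.dartLength d) - 1) / y d (G.dartLength d) with hm
  have hm0 : ∀ d, 0 ≤ m d := fun d => by
    have h1 := (h d.symm).one_le_deriv (h d.symm).right_mem
    rw [dartLength_symm] at h1
    exact div_nonneg (by linarith) (hpos d).le
  have hmI : ∀ d, m d ≤ potentialIntegral q d := fun d => by
    have h1 := (h d.symm).deriv_sub_one_le
    change _ ≤ potentialIntegral q d.symm * _ at h1
    rw [potentialIntegral_symm, dartLength_symm, hsymm] at h1
    exact (div_le_iff₀ (hpos d)).2 h1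
  -- `y ℓ ≤ 2 ℓ` unless the potential is large, which happens on finitely many edges only
  obtain ⟨κ, hκ, hκc⟩ : ∃ κ : ℝ, 0 < κ ∧ ∀ d, κ ≤ c d * G.dartLength d := by
    have hfin := hsmall (1 / 2) (by norm_num)
    obtain ⟨M, hM⟩ := (hfin.image fun d => y d (G.dartLength d) / G.dartLength d).bddAbove
    have hMpos : 0 < max M 2 := two_pos.trans_le (le_max_right _ _)
    refine ⟨1 / max M 2, by positivity, fun d => ?_⟩
    have hℓ := G.dartLength_pos d
    rw [hc, one_div_mul_eq_div, div_le_div_iff₀ hMpos (hpos d), one_mul, mul_comm,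
      ← div_le_iff₀ hℓ]
    by_cases hd : 1 / 2 < G.dartLength d * potentialIntegral q d
    · exact (hM ⟨d, hd, rfl⟩).trans (le_max_left _ _)
    · refine le_trans ?_ (le_max_right _ _)
      rw [div_le_iff₀ hℓ]
      have h1 := (h d).right_le
      change _ ≤ _ + _ * potentialIntegral q d * _ at h1
      nlinarith [mul_le_mul_of_nonneg_right (not_lt.1 hd) (hpos d).le]
  refine ⟨a, c, m, κ, fun ε hε => ?_, hκ, hκc, fun d => ?_, hm0,
    Summable.of_nonneg_of_le hm0 hmI hsum, fun F hF => ?_⟩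
  · refine (hsmall ε hε).subset ?_
    rintro d ⟨t, ht, hd⟩
    exact hd.trans_le ((h d).div_sub_div_le ht)
  · simp only [hc, dartLength_symm, hsymm]
  · have hsol : ∀ d, IsSchrodingerSolution (G.onDart q d) (G.dartLength d)
        (G.onDart (a.interp F) d) (fun t => F d.snd / y d (G.dartLength d) * z d t +
          F d.fst / y d (G.dartLength d) * -z d.symm (G.dartLength d - t)) := by
      intro d
      have h1 := (h d).linearCombination (h d.symm).toIsSchrodingerSolution.of_symm
        (F d.snd / y d (G.dartLength d)) (F d.fst / y d (G.dartLength d))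
      refine h1.congr_solution fun t ht => ?_
      rw [onDart, EdgeProfile.interp_dartPoint _ _ d ht]
      simp only [a, dartLength_symm, hsymm]
      ring
    refine isHarmonic_of_isSchrodingerSolution hsol fun v hv => ?_
    refine neg_eq_zero.1 (Eq.trans ?_ (hF v hv))
    rw [← Finset.sum_neg_distrib]
    refine Finset.sum_congr rfl fun w _ => ?_
    simp only [hc, hm, sub_zero, (h _).deriv_zero]
    change -(F w / _ * 1 + F v / _ * _) = _
    ring

end MetricGraph

namespace MetricGraph

variable {V : Type*} {G : MetricGraph V}

/-! ### The Dirichlet problem -/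

/-- The Dirichlet problem for boundary values that extend to an eventually flat function. -/
theorem exists_solution_of_eventuallyFlat [CompactSpace G.Completion] (hconn : G.graph.Connected)
    (hb : G.boundary.Nonempty) {a : G.EdgeProfile} (ha : a.IsAsymptoticallyLinear)
    {c m : G.graph.Dart → ℝ} {κ : ℝ} (hκ : 0 < κ)
    (hc : ∀ d, κ ≤ c d * G.dartLength d) (hcs : ∀ d, c d.symm = c d) (hm : ∀ d, 0 ≤ m d)
    (hms : Summable m) {Φ : C(G.Completion, ℝ)} (hΦ : Φ ∈ G.eventuallyFlat) :
    ∃ F : V → ℝ, (∀ v, 2 ≤ G.graph.degree v → ∑ w : G.graph.neighborSet v,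
        (c (G.graph.dartOfNeighborSet v w) * (F v - F w) +
          m (G.graph.dartOfNeighborSet v w) * F v) = 0) ∧
      UniformContinuous (a.interp F) ∧
      ∀ x ∈ G.boundary, UniformSpace.Completion.extension (a.interp F) x = Φ x := by
  have hdart := exists_dart_fst_eq hconn hb
  obtain ⟨S, hS, hSΦ⟩ := hΦ
  set φ : V → ℝ := fun v => Φ (G.vertexPoint v) with hφdef
  have hφS : ∀ d ∉ S, φ d.snd = φ d.fst := fun d hd => by
    simp only [hφdef]
    rw [← hSΦ d hd _ (right_mem_Icc.2 (G.dartLength_pos d).le), dartPoint_length]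
  have hφ : φ ∈ G.flatVertexFunctions := by
    refine ⟨?_, hS.subset fun d hd => by_contra fun h => hd (hφS d h)⟩
    obtain ⟨M, hM⟩ := isCompact_univ.exists_bound_of_continuousOn Φ.continuous.continuousOn
    exact ⟨M, fun v => hM _ (mem_univ _)⟩
  obtain ⟨F, happrox, hF⟩ := exists_discrete_solution hconn hb hκ hc hcs hm hms hφ
  -- each approximation `φ - f` has the right boundary values, as `f` is a test function
  have hstep : ∀ ε > 0, ∃ h : G.Point → ℝ, UniformContinuous h ∧ (∀ p, |a.interp F p - h p| ≤ ε) ∧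
      ∀ x ∈ G.boundary, UniformSpace.Completion.extension h x = Φ x := by
    intro ε hε
    obtain ⟨f, hf, hfF⟩ := happrox ε hε
    obtain ⟨⟨M, hM⟩, hfin⟩ := G.flatVertexFunctions.sub_mem hφ (testFunctions_le hf)
    set S' : Set G.graph.Dart := {d | (φ - f) d.snd ≠ (φ - f) d.fst} ∪
      (S ∪ ⋃ v ∈ f.support, {d | d.fst = v ∨ d.snd = v}) with hS'
    have hS'fin : S'.Finite :=
      hfin.union (hS.union (hf.1.biUnion fun v _ => finite_setOf_incident G v))
    have hflat : ∀ d ∉ S', (φ - f) d.snd = (φ - f) d.fst := fun d hd =>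
      by_contra fun h => hd (Or.inl h)
    have hu := a.uniformContinuous_interp ha hM hS'fin hflat
    refine ⟨a.interp (φ - f), hu, fun p => ?_, ?_⟩
    · rw [← a.interp_sub]
      exact a.abs_interp_le _ hfF p
    · rintro x (⟨v, hv, rfl⟩ | hx)
      · rw [coe_extension hu, EdgeProfile.interp_vertexPoint, Pi.sub_apply, hf.2 v hv, sub_zero]
      · refine a.extension_interp_eq ha hdart hM hS'fin hflat hx Φ.continuous.continuousAt
          fun d hd t ht => ?_
        simp only [hS', mem_union, not_or] at hd
        have hf0 : f d.fst = 0 := by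
          by_contra h
          exact hd.2.2 (mem_biUnion h (Or.inl rfl))
        rw [hSΦ d hd.2.1 t ht, Pi.sub_apply, hf0, sub_zero]
  have huF : UniformContinuous (a.interp F) := uniformContinuous_of_approx fun δ hδ => by
    obtain ⟨h, h1, h2, -⟩ := hstep δ hδ
    exact ⟨h, h1, h2⟩
  refine ⟨F, hF, huF, fun x hx => eq_of_forall_dist_le fun ε hε => ?_⟩
  obtain ⟨h, h1, h2, h3⟩ := hstep ε hε
  rw [Real.dist_eq, ← h3 x hx]
  exact abs_extension_sub_le huF h1 h2 x

/-- Boundary values can be approximated by eventually flat functions, by the Stone–Weierstrass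
theorem. -/
theorem exists_eventuallyFlat_near [CompactSpace G.Completion] (hconn : G.graph.Connected)
    (hweak : G.WeaklyConnected) (hb : G.boundary.Nonempty) {U : G.boundary → ℝ} (hU : Continuous U)
    {ε : ℝ} (hε : 0 < ε) : ∃ Φ ∈ G.eventuallyFlat, ∀ x : G.boundary, |Φ x - U x| < ε := by
  have hdart := exists_dart_fst_eq hconn hb
  have : CompactSpace G.boundary := isCompact_iff_compactSpace.1 (isClosed_boundary hdart).isCompact
  let r : C(G.Completion, ℝ) →ₐ[ℝ] C(G.boundary, ℝ) :=
    ContinuousMap.compRightAlgHom ℝ ℝ ⟨Subtype.val, continuous_subtype_val⟩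
  have hsep : (G.eventuallyFlat.map r).SeparatesPoints := by
    intro x y hxy
    obtain ⟨Φ, hΦ, hne⟩ := exists_eventuallyFlat_ne hweak hdart x.2 y.2
      (Subtype.coe_injective.ne hxy)
    exact ⟨r Φ, ⟨r Φ, ⟨Φ, hΦ, rfl⟩, rfl⟩, hne⟩
  obtain ⟨⟨_, ⟨Φ, hΦ, rfl⟩⟩, hg⟩ :=
    ContinuousMap.exists_mem_subalgebra_near_continuous_of_separatesPoints _ hsep U hU ε hε
  exact ⟨Φ, hΦ, hg⟩

open Filter Topology in
/-- Existence for arbitrary continuous boundary values, as a uniform limit of the solutions for eventually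
flat ones. -/
theorem exists_harmonic_extension [CompactSpace G.Completion] (hconn : G.graph.Connected)
    (hweak : G.WeaklyConnected) (hb : G.boundary.Nonempty) {q : G.Point → ℝ} (hq : ∀ x, 0 ≤ q x)
    (hq_loc : G.LocallyIntegrable q)
    (hsum : Summable (potentialIntegral q : G.graph.Dart → ℝ))
    {U : G.boundary → ℝ} (hU : Continuous U) :
    ∃ u : G.Completion → ℝ, Continuous u ∧ (∀ x : G.boundary, u x = U x) ∧
      G.IsHarmonic q (fun x : G.Point => u x) := by
  obtain ⟨a, c, m, κ, ha, hκ, hc, hcs, hm, hms, hharm⟩ := exists_edgeProfile hq hq_loc hsum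
  have hδpos : ∀ n : ℕ, 0 < 1 / ((n : ℝ) + 1) := fun n => Nat.one_div_pos_of_nat
  choose Φ hΦ hΦU using fun n : ℕ => exists_eventuallyFlat_near hconn hweak hb hU (hδpos n)
  choose F hF huc hFΦ using fun n =>
    exists_solution_of_eventuallyFlat hconn hb ha hκ hc hcs hm hms (hΦ n)
  set u : ℕ → G.Completion → ℝ := fun n => UniformSpace.Completion.extension (a.interp (F n))
    with hu
  have hucont : ∀ n, Continuous (u n) := fun n => UniformSpace.Completion.continuous_extension
  have hucoe : ∀ n, (fun x : G.Point => u n x) = a.interp (F n) := fun n =>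
    funext fun p => coe_extension (huc n) p
  have hclose : ∀ n k x, |u n x - u k x| ≤ 1 / ((n : ℝ) + 1) + 1 / ((k : ℝ) + 1) := by
    intro n k
    refine IsHarmonic.abs_le_of_boundary (q := q) hconn hb hq ((hucont n).sub (hucont k)) ?_
      fun x hx => ?_
    · have h1 := hharm _ (hF n)
      have h2 := hharm _ (hF k)
      rw [← hucoe] at h1 h2
      exact h1.sub h2
    · have e1 : u n x = Φ n x := hFΦ n x hx
      have e2 : u k x = Φ k x := hFΦ k x hx
      rw [Pi.sub_apply, e1, e2]
      have h1 := hΦU n ⟨x, hx⟩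
      have h2 := hΦU k ⟨x, hx⟩
      have h3 := _root_.abs_sub_le (Φ n x) (U ⟨x, hx⟩) (Φ k x)
      rw [abs_sub_comm (U _)] at h3
      linarith
  have hFu : ∀ n v, F n v = u n (G.vertexPoint v) := fun n v => (congrFun (hucoe n) (G.vertexPoint v)).symm
  have hδlim : Tendsto (fun n : ℕ => 1 / ((n : ℝ) + 1)) atTop (𝓝 0) :=
    tendsto_one_div_add_atTop_nhds_zero_nat
  have hcauchy : ∀ v, CauchySeq fun n => F n v := fun v => by
    refine cauchySeq_of_le_tendsto_0 (fun n : ℕ => 2 * (1 / ((n : ℝ) + 1))) (fun n k N hn hk => ?_)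
      (by simpa using hδlim.const_mul 2)
    rw [hFu, hFu, Real.dist_eq, two_mul]
    exact (hclose n k _).trans (add_le_add (Nat.one_div_le_one_div hn) (Nat.one_div_le_one_div hk))
  choose F' hF' using fun v => cauchySeq_tendsto_of_complete (hcauchy v)
  have hunif : ∀ n v, |F n v - F' v| ≤ 1 / ((n : ℝ) + 1) := fun n v => by
    have h1 : Tendsto (fun k : ℕ => 1 / ((n : ℝ) + 1) + 1 / ((k : ℝ) + 1)) atTop
        (𝓝 (1 / ((n : ℝ) + 1) + 0)) := tendsto_const_nhds.add hδlim
    rw [add_zero] at h1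
    refine le_of_tendsto_of_tendsto' ((tendsto_const_nhds.sub (hF' v)).abs) h1 fun k => ?_
    rw [hFu, hFu]
    exact hclose n k _
  have hinterp : ∀ n p, |a.interp F' p - a.interp (F n) p| ≤ 1 / ((n : ℝ) + 1) := fun n p => by
    rw [abs_sub_comm, ← a.interp_sub]
    exact a.abs_interp_le _ (hunif n) p
  have hlt : ∀ δ > 0, ∃ n : ℕ, 1 / ((n : ℝ) + 1) < δ := fun δ hδ => exists_nat_one_div_lt hδ
  have huc' : UniformContinuous (a.interp F') := uniformContinuous_of_approx fun δ hδ => by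
    obtain ⟨n, hn⟩ := hlt δ hδ
    exact ⟨_, huc n, fun p => (hinterp n p).trans hn.le⟩
  refine ⟨UniformSpace.Completion.extension (a.interp F'),
    UniformSpace.Completion.continuous_extension, fun x => ?_, ?_⟩
  · refine eq_of_forall_dist_le fun δ hδ => ?_
    obtain ⟨n, hn⟩ := hlt (δ / 2) (half_pos hδ)
    have h1 := abs_extension_sub_le huc' (huc n) (hinterp n) x
    rw [hFΦ n x x.2] at h1
    rw [Real.dist_eq]
    linarith [_root_.abs_sub_le (UniformSpace.Completion.extension (a.interp F') (x : G.Completion))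
      (Φ n x) (U x), hΦU n x]
  · rw [show (fun x : G.Point => UniformSpace.Completion.extension (a.interp F') (x : G.Completion))
      = a.interp F' from funext fun p => coe_extension huc' p]
    refine hharm F' fun v hv => ?_
    have hlim : Tendsto (fun n => ∑ w : G.graph.neighborSet v,
        (c (G.graph.dartOfNeighborSet v w) * (F n v - F n w) +
          m (G.graph.dartOfNeighborSet v w) * F n v)) atTop (𝓝 (∑ w : G.graph.neighborSet v,
        (c (G.graph.dartOfNeighborSet v w) * (F' v - F' w) +
          m (G.graph.dartOfNeighborSet v w) * F' v))) := by
      refine tendsto_finsetSum _ fun w _ => ?_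
      exact (((hF' v).sub (hF' w)).const_mul _).add ((hF' v).const_mul _)
    simp only [hF _ v hv] at hlim
    exact tendsto_nhds_unique hlim tendsto_const_nhds

end MetricGraph

theorem mainTheorem2 {V : Type*} [Countable V] (G : MetricGraph V)
    (hconn : G.graph.Connected) (hweak : G.WeaklyConnected) (hcompact : CompactSpace G.Completion)
    (hboundary : G.boundary.Nonempty)
    (q : G.Point → ℝ) (hq_nonneg : ∀ x, 0 ≤ q x) (hq_loc : G.LocallyIntegrable q)
    (ω : G.graph.edgeSet → ℝ) (hω_pos : ∀ e, 0 < ω e) (hω_sum : Summable ω)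
    (hqω : ∑' e, G.edgeIntegral (fun x => ENNReal.ofReal (((ω e)⁻¹ * q x) ^ 2 * ω e)) e < ⊤)
    (U : G.boundary → ℝ) (hU : Continuous U) :
    ∃! u : G.Completion → ℝ, Continuous u ∧ (∀ x : G.boundary, u x = U x) ∧
      G.IsHarmonic q (fun x : G.Point => u x) := by
  have hsum := MetricGraph.summable_potentialIntegral hq_nonneg hq_loc hω_pos hω_sum hqω
  obtain ⟨u, hu, hub, huh⟩ :=
    MetricGraph.exists_harmonic_extension hconn hweak hboundary hq_nonneg hq_loc hsum hU
  refine ⟨u, ⟨hu, hub, huh⟩, fun u' ⟨hu', hub', huh'⟩ => funext fun x => ?_⟩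
  have h := (huh'.sub huh).abs_le_of_boundary (u := fun x => u' x - u x) hconn hboundary hq_nonneg
    (hu'.sub hu) (M := 0) (fun y hy => by
      rw [hub ⟨y, hy⟩, hub' ⟨y, hy⟩, sub_self, abs_zero]) x
  exact sub_eq_zero.1 (abs_nonpos_iff.1 h)
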